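/- **Theorem.** Let $T(x)=\frac{1}{\lfloor 1/x\rfloor}\left(\frac1x-\lfloor 1/x\rfloor\right)$ for $x\in(0,1]$ be the Engel continued fraction map, and let $b_n(x)=\lfloor 1/T^{n-1}x\rfloor$, $n\ge 1$, be the partial quotients of the Engel continued fraction expansion of $x\in(0,1]$ (for every $n$ they are defined for all irrational $x$, hence almost everywhere). Let $\mathbf P$ be Lebesgue measure on $(0,1]$ and $X_n=\frac{\log b_n-n}{n}$. Then $\{X_n:n\ge1\}$ satisfies a large deviation principle with speed $n$ and good rate function $$I(x)=\begin{cases}x-\log(x+1), & x>-\frac{\sqrt5-1}{2};\\[2pt] -\frac{\sqrt5+1}{2}(x+1)+2\log\frac{\sqrt5+1}{2}, & -1\le x\le-\frac{\sqrt5-1}{2};\\[2pt] +\infty, & x<-1.\end{cases}$$ That is, $I:\mathbb R\to[0,\infty]$ is lower semicontinuous with compact level sets $\{x: I(x)\le c\}$, $c\in\mathbb R$, and for every Borel set $\Gamma\subseteq\mathbb R$, with interior $\Gamma^\circ$ and closure $\overline\Gamma$, $$-\inf_{x\in\Gamma^\circ}I(x)\le\liminf_{n\to\infty}\frac1n\log\mathbf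 P(X_n\in\Gamma)\le\limsup_{n\to\infty}\frac1n\log\mathbf P(X_n\in\Gamma)\le-\inf_{x\in\overline\Gamma}I(x),$$ where $\log 0=-\infty$ and $\inf\emptyset=+\infty$. -/

import Mathlib

open MeasureTheory Filter

namespace EngelCF

/-- The integer `b₁(x) = [1/x]`, for `x ∈ (0,1]`. (At `x = 0` the value is `0`.) -/
noncomputable def firstQuotient (x : ℝ) : ℕ := ⌊1 / x⌋₊

/-- The map `T x = (1 / [1/x]) * (1/x - [1/x])` generating the Engel continued fraction.
It sends `(0,1]` to `[0,1)`, and `0` to `0`. -/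
noncomputable def ecfMap (x : ℝ) : ℝ :=
  1 / (firstQuotient x : ℝ) * (1 / x - (firstQuotient x : ℝ))

/-- The `n`-th partial quotient `b_n(x) = b₁(T^(n-1) x)` for `n ≥ 1`. The value is `0` once the
orbit of `x` has reached `0`, which happens only on the null set of rational `x`. -/
noncomputable def partialQuotient (n : ℕ) (x : ℝ) : ℕ := firstQuotient (ecfMap^[n - 1] x)

/-- Lebesgue measure on `(0,1]`. -/
noncomputable def lebesgueUnit : Measure ℝ := volume.restrict (Set.Ioc (0 : ℝ) 1)

/-- Good rate functions: nonnegative, extended-real valued, lower semicontinuous and with compact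
level sets. -/
structure IsGoodRateFunction (I : ℝ → EReal) : Prop where
  nonneg : ∀ x, 0 ≤ I x
  lowerSemicontinuous : LowerSemicontinuous I
  isCompact_level : ∀ c : ℝ, IsCompact {x | I x ≤ (c : EReal)}

/-- The sequence of real random variables `X 1, X 2, …` on `(Ω, P)` satisfies the large deviation
principle with speed `n` and good rate function `I`. The logarithm of a probability and the
infima are taken in the extended reals, so that `log 0 = -∞` and `inf ∅ = +∞`. -/
structure SatisfiesLDP {Ω : Type*} [MeasurableSpace Ω] (P : Measure Ω) (X : ℕ → Ω → ℝ)
    (I : ℝ → EReal) : Prop where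
  measurable : ∀ n, 1 ≤ n → Measurable (X n)
  goodRate : IsGoodRateFunction I
  lower : ∀ Γ : Set ℝ, MeasurableSet Γ →
    -(⨅ x ∈ interior Γ, I x) ≤
      liminf (fun n : ℕ => ENNReal.log (P {ω | X n ω ∈ Γ}) / (n : EReal)) atTop
  upper : ∀ Γ : Set ℝ, MeasurableSet Γ →
    limsup (fun n : ℕ => ENNReal.log (P {ω | X n ω ∈ Γ}) / (n : EReal)) atTop ≤
      -(⨅ x ∈ closure Γ, I x)

open Classical in
/-- The explicit rate function. -/
noncomputable def rateFunction (x : ℝ) : EReal :=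
  if -((√5 - 1) / 2) < x then ((x - Real.log (x + 1) : ℝ) : EReal)
  else if -1 ≤ x then
    ((-((√5 + 1) / 2) * (x + 1) + 2 * Real.log ((√5 + 1) / 2) : ℝ) : EReal)
  else ⊤

end EngelCF

/-! Under Lebesgue measure the partial quotients, together with a slope `s`, form a Markov chain:
given the past, the current point of the orbit has a density proportional to `(1 + s y)⁻²` on `(0,
1/b]`. The inverse branches of the map are Möbius, so this family is preserved (`lintegral_cell`),
and the law of `b_n` becomes a power of `stepOp` (`lebesgueUnit_partialQuotient`).

The level never decreases. High up, a step multiplies it by a nearly Pareto factor, so `log b_n`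
gains nearly exponential increments of mean 1, and a step multiplies `m ^ θ` on average by about `1
/ (1 - θ)`. The Legendre transform of `-log (1 - θ)` at `1 + x` is `x - log (x + 1)`. Low levels
matter only through waiting: level 1 is kept for `k` steps with probability of order `(1 + φ) ^
(-k)`, higher levels with probability at most `1/3 < 1 / (1 + φ)` per step. Hence waiting at 1
dominates exactly when `1 / (1 - θ) < 1 / (1 + φ)`, that is `θ < -φ`, and the rate continues below
`ψ` along its tangent of slope `-φ`.

Upper bound: `exists_stepOp_pow_powObs_le` bounds the moments for `-φ < θ < 1`, and Chernoff's
inequality is optimised over these `θ`. Lower bound: wait at level 1 for a proportion `κ` of the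
time, jump to a high level, then grow at speed `v` (`le_stepOp_pow_window`). -/

namespace EngelCF

open Set
open scoped ENNReal goldenRatio

/-! ### The transition operator -/

/-- Under the density `(b + s) / (1 + s y) ^ 2` on `(0, 1/b]`, the probability that the next
partial quotient is `m`. -/
noncomputable def transWeight (b : ℕ) (s : ℝ) (m : ℕ) : ℝ := (b + s) / ((m + s) * (m + 1 + s))

/-- The parameter of the conditional density after the partial quotient `m` has been observed. -/
noncomputable def nextSlope (m : ℕ) (s : ℝ) : ℝ := m / (m + s)

/-- The transition operator of the Markov chain of partial quotients and slopes. -/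
noncomputable def stepOp : (ℕ → ℝ → ℝ≥0∞) →ₗ[ℝ≥0∞] (ℕ → ℝ → ℝ≥0∞) where
  toFun f b s :=
    ∑' j, ENNReal.ofReal (transWeight b s (b + j)) * f (b + j) (nextSlope (b + j) s)
  map_add' f g := by
    ext b s
    simp only [Pi.add_apply, mul_add]
    exact ENNReal.tsum_add
  map_smul' c f := by
    ext b s
    simp only [Pi.smul_apply, smul_eq_mul, RingHom.id_apply]
    rw [← ENNReal.tsum_mul_left]
    exact tsum_congr fun j => by ring

lemma stepOp_apply (f : ℕ → ℝ → ℝ≥0∞) (b : ℕ) (s : ℝ) :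
    stepOp f b s =
      ∑' j, ENNReal.ofReal (transWeight b s (b + j)) * f (b + j) (nextSlope (b + j) s) := rfl

lemma stepOp_pow_succ (f : ℕ → ℝ → ℝ≥0∞) (n : ℕ) :
    (stepOp ^ (n + 1)) f = stepOp ((stepOp ^ n) f) := by
  rw [pow_succ']; rfl

lemma nextSlope_mem (m : ℕ) {s : ℝ} (hs : s ∈ Icc (0 : ℝ) 1) : nextSlope m s ∈ Icc (0 : ℝ) 1 := by
  have := hs.1
  exact ⟨by unfold nextSlope; positivity, div_le_one_of_le₀ (by linarith) (by positivity)⟩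

lemma transWeight_nonneg (b m : ℕ) {s : ℝ} (hs : 0 ≤ s) : 0 ≤ transWeight b s m := by
  unfold transWeight; positivity

/-- The chain never goes down, so a comparison on the levels from `L` on is preserved there. This
lets estimates valid only at high levels be iterated. -/
lemma stepOp_mono {L : ℕ} {f g : ℕ → ℝ → ℝ≥0∞}
    (h : ∀ m, L ≤ m → ∀ s ∈ Icc (0 : ℝ) 1, f m s ≤ g m s) {b : ℕ} (hb : L ≤ b) {s : ℝ}
    (hs : s ∈ Icc (0 : ℝ) 1) : stepOp f b s ≤ stepOp g b s := by
  rw [stepOp_apply, stepOp_apply]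
  gcongr with j
  exact h _ (by omega) _ (nextSlope_mem _ hs)

lemma stepOp_pow_mono {L : ℕ} {f g : ℕ → ℝ → ℝ≥0∞}
    (h : ∀ m, L ≤ m → ∀ s ∈ Icc (0 : ℝ) 1, f m s ≤ g m s) (n : ℕ) :
    ∀ b, L ≤ b → ∀ s ∈ Icc (0 : ℝ) 1, (stepOp ^ n) f b s ≤ (stepOp ^ n) g b s := by
  induction n with
  | zero => simpa using h
  | succ n ih =>
    intro b hb s hs
    rw [stepOp_pow_succ, stepOp_pow_succ]
    exact stepOp_mono ih hb hs

lemma stepOp_pow_le {L : ℕ} {V : ℕ → ℝ → ℝ≥0∞} {c : ℝ≥0∞}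
    (h : ∀ m, L ≤ m → ∀ s ∈ Icc (0 : ℝ) 1, stepOp V m s ≤ c * V m s) (n : ℕ) :
    ∀ b, L ≤ b → ∀ s ∈ Icc (0 : ℝ) 1, (stepOp ^ n) V b s ≤ c ^ n * V b s := by
  induction n with
  | zero => simp
  | succ n ih =>
    intro b hb s hs
    rw [stepOp_pow_succ]
    calc stepOp ((stepOp ^ n) V) b s ≤ stepOp (c ^ n • V) b s := stepOp_mono ih hb hs
      _ = c ^ n * stepOp V b s := by rw [map_smul]; rfl
      _ ≤ c ^ n * (c * V b s) := by gcongr; exact h b hb s hs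
      _ = c ^ (n + 1) * V b s := by ring

lemma le_stepOp_pow {L : ℕ} {V : ℕ → ℝ → ℝ≥0∞} {c : ℝ≥0∞}
    (h : ∀ m, L ≤ m → ∀ s ∈ Icc (0 : ℝ) 1, c * V m s ≤ stepOp V m s) (n : ℕ) :
    ∀ b, L ≤ b → ∀ s ∈ Icc (0 : ℝ) 1, c ^ n * V b s ≤ (stepOp ^ n) V b s := by
  induction n with
  | zero => simp
  | succ n ih =>
    intro b hb s hs
    rw [stepOp_pow_succ]
    calc c ^ (n + 1) * V b s = c ^ n * (c * V b s) := by ring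
      _ ≤ c ^ n * stepOp V b s := by gcongr; exact h b hb s hs
      _ = stepOp (c ^ n • V) b s := by rw [map_smul]; rfl
      _ ≤ stepOp ((stepOp ^ n) V) b s := stepOp_mono ih hb hs

/-! ### Power moments at high levels -/

/-- The power `m ^ θ` as an observable of the chain. -/
noncomputable def powObs (θ : ℝ) : ℕ → ℝ → ℝ≥0∞ := fun m _ => ENNReal.ofReal ((m : ℝ) ^ θ)

/-- Increments of `m ^ (θ - 1)`, which compare with `(1 - θ) m ^ (θ - 2)`. -/
lemma rpow_sub_one_increment {θ : ℝ} (hθ : θ < 1) {x : ℝ} (hx : 0 < x) :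
    (1 - θ) * (x + 1) ^ (θ - 2) ≤ x ^ (θ - 1) - (x + 1) ^ (θ - 1) ∧
      x ^ (θ - 1) - (x + 1) ^ (θ - 1) ≤ (1 - θ) * x ^ (θ - 2) := by
  obtain ⟨c, hc, hc'⟩ := exists_hasDerivAt_eq_slope (fun y : ℝ => y ^ (θ - 1))
    (fun y => (θ - 1) * y ^ (θ - 1 - 1)) (show x < x + 1 by linarith)
    (ContinuousOn.rpow_const continuousOn_id fun y hy => Or.inl (by
      have := hy.1; exact ne_of_gt (by linarith)))
    (fun y hy => Real.hasDerivAt_rpow_const (Or.inl (by have := hy.1; linarith)))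
  have e : θ - 1 - 1 = θ - 2 := by ring
  simp only [e, add_sub_cancel_left, div_one] at hc'
  have h1 : c ^ (θ - 2) ≤ x ^ (θ - 2) :=
    Real.rpow_le_rpow_of_nonpos hx hc.1.le (by linarith)
  have h2 : (x + 1) ^ (θ - 2) ≤ c ^ (θ - 2) :=
    Real.rpow_le_rpow_of_nonpos (hx.trans hc.1) hc.2.le (by linarith)
  have h3 : 0 < 1 - θ := by linarith
  have h4 := mul_le_mul_of_nonneg_left h1 h3.le
  have h5 := mul_le_mul_of_nonneg_left h2 h3.le
  constructor <;> nlinarith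

lemma tsum_rpow_increment {θ : ℝ} (hθ : θ < 1) {b : ℕ} (hb : 1 ≤ b) :
    ∑' j : ℕ, ENNReal.ofReal (((b + j : ℕ) : ℝ) ^ (θ - 1) - (((b + j : ℕ) : ℝ) + 1) ^ (θ - 1)) =
      ENNReal.ofReal ((b : ℝ) ^ (θ - 1)) := by
  have hnn : ∀ j : ℕ,
      0 ≤ ((b + j : ℕ) : ℝ) ^ (θ - 1) - (((b + j : ℕ) : ℝ) + 1) ^ (θ - 1) := by
    intro j
    have hp : (0 : ℝ) < ((b + j : ℕ) : ℝ) := by exact_mod_cast (by omega)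
    exact sub_nonneg.2 (Real.rpow_le_rpow_of_nonpos hp (by linarith) (by linarith))
  have hs : HasSum (fun j : ℕ =>
      ((b + j : ℕ) : ℝ) ^ (θ - 1) - (((b + j : ℕ) : ℝ) + 1) ^ (θ - 1)) ((b : ℝ) ^ (θ - 1)) := by
    rw [hasSum_iff_tendsto_nat_of_nonneg hnn]
    have e : ∀ n : ℕ, ∑ j ∈ Finset.range n,
        (((b + j : ℕ) : ℝ) ^ (θ - 1) - (((b + j : ℕ) : ℝ) + 1) ^ (θ - 1)) =
        (b : ℝ) ^ (θ - 1) - ((b + n : ℕ) : ℝ) ^ (θ - 1) := by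
      intro n
      have := Finset.sum_range_sub' (fun j : ℕ => ((b + j : ℕ) : ℝ) ^ (θ - 1)) n
      simpa [add_assoc] using this
    simp only [e]
    have ht : Tendsto (fun n : ℕ => ((b + n : ℕ) : ℝ) ^ (θ - 1)) atTop (nhds 0) := by
      have h1 := (tendsto_rpow_neg_atTop (show 0 < 1 - θ by linarith)).comp
        (tendsto_natCast_atTop_atTop.comp (tendsto_add_atTop_nat b))
      refine h1.congr fun n => ?_
      simp [add_comm]
    simpa using ht.const_sub ((b : ℝ) ^ (θ - 1))
  rw [← ENNReal.ofReal_tsum_of_nonneg hnn hs.summable, hs.tsum_eq]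

/-- The weight of `m` is at most `(b + 1) / m ^ 2`, and `m ^ (θ - 2)` is comparable to a telescoping
increment. Replacing `m + 1` by `m` costs `(1 + 1/L) ^ (2 - θ)`, and replacing `b + 1` by `b` one
more factor. -/
lemma stepOp_powObs_le_aux {θ : ℝ} (hθ : θ < 1) {L b : ℕ} (hL : 1 ≤ L) (hb : L ≤ b) {s : ℝ}
    (hs : s ∈ Icc (0 : ℝ) 1) :
    stepOp (powObs θ) b s ≤
      ENNReal.ofReal ((1 + 1 / (L : ℝ)) ^ (3 - θ) / (1 - θ)) * powObs θ b s := by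
  have hb0 : (0 : ℝ) < b := by exact_mod_cast (by omega)
  have hL0 : (0 : ℝ) < L := by exact_mod_cast (by omega)
  have h1θ : 0 < 1 - θ := by linarith
  rw [stepOp_apply]
  have key : ∀ j : ℕ, ENNReal.ofReal (transWeight b s (b + j)) *
      powObs θ (b + j) (nextSlope (b + j) s) ≤
      ENNReal.ofReal ((b + 1) * (1 + 1 / (L : ℝ)) ^ (2 - θ) / (1 - θ)) *
      ENNReal.ofReal (((b + j : ℕ) : ℝ) ^ (θ - 1) - (((b + j : ℕ) : ℝ) + 1) ^ (θ - 1)) := by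
    intro j
    have hm : (0 : ℝ) < ((b + j : ℕ) : ℝ) := by exact_mod_cast (by omega)
    have hLm : (L : ℝ) ≤ ((b + j : ℕ) : ℝ) := by exact_mod_cast (by omega)
    unfold powObs
    rw [← ENNReal.ofReal_mul (transWeight_nonneg _ _ hs.1), ← ENNReal.ofReal_mul (by positivity)]
    apply ENNReal.ofReal_le_ofReal
    set m : ℝ := ((b + j : ℕ) : ℝ) with hmdef
    have h1 := (rpow_sub_one_increment hθ hm).1
    have h2 : transWeight b s (b + j) ≤ (b + 1) / m ^ 2 := by
      unfold transWeight
      rw [← hmdef]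
      have := hs.1
      have := hs.2
      gcongr
      nlinarith
    have h3 : m ^ (θ - 2) ≤ (1 + 1 / (L : ℝ)) ^ (2 - θ) * (m + 1) ^ (θ - 2) := by
      have e1 : m + 1 ≤ (1 + 1 / (L : ℝ)) * m := by
        have : 1 ≤ 1 / (L : ℝ) * m := by rw [one_div, ← div_eq_inv_mul, one_le_div hL0]; exact hLm
        linarith
      have e2 : (m + 1) ^ (2 - θ) ≤ (1 + 1 / (L : ℝ)) ^ (2 - θ) * m ^ (2 - θ) := by
        rw [← Real.mul_rpow (by positivity) hm.le]
        exact Real.rpow_le_rpow (by linarith) e1 (by linarith)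
      have e3 : θ - 2 = -(2 - θ) := by ring
      rw [e3, Real.rpow_neg hm.le, Real.rpow_neg (by positivity), ← div_eq_mul_inv, le_div_iff₀
        (by positivity), ← div_eq_inv_mul, div_le_iff₀ (by positivity)]
      exact e2
    have h4 : m ^ θ = m ^ (θ - 2) * m ^ 2 := by
      rw [← Real.rpow_natCast, ← Real.rpow_add hm]; norm_num
    calc transWeight b s (b + j) * m ^ θ ≤ (b + 1) / m ^ 2 * m ^ θ := by gcongr
      _ = (b + 1) * m ^ (θ - 2) := by rw [h4]; field_simp
      _ ≤ (b + 1) * ((1 + 1 / (L : ℝ)) ^ (2 - θ) * (m + 1) ^ (θ - 2)) := by gcongr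
      _ = (b + 1) * (1 + 1 / (L : ℝ)) ^ (2 - θ) / (1 - θ) * ((1 - θ) * (m + 1) ^ (θ - 2)) := by
        field_simp
      _ ≤ _ := by gcongr
  refine (ENNReal.tsum_le_tsum key).trans ?_
  rw [ENNReal.tsum_mul_left, tsum_rpow_increment hθ (by omega)]
  unfold powObs
  rw [← ENNReal.ofReal_mul (by positivity), ← ENNReal.ofReal_mul (by positivity)]
  apply ENNReal.ofReal_le_ofReal
  have e1 : (b : ℝ) + 1 ≤ (1 + 1 / (L : ℝ)) * b := by
    have : 1 ≤ 1 / (L : ℝ) * b := by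
      rw [one_div, ← div_eq_inv_mul, one_le_div hL0]; exact_mod_cast hb
    linarith
  have e2 : (1 + 1 / (L : ℝ)) ^ (3 - θ) = (1 + 1 / (L : ℝ)) ^ (2 - θ) * (1 + 1 / (L : ℝ)) := by
    rw [show 3 - θ = (2 - θ) + 1 by ring, Real.rpow_add (by positivity), Real.rpow_one]
  have e3 : (b : ℝ) ^ θ = b ^ (θ - 1) * b := by
    rw [← Real.rpow_add_one hb0.ne']; ring_nf
  rw [e2, e3]
  calc ((b : ℝ) + 1) * (1 + 1 / (L : ℝ)) ^ (2 - θ) / (1 - θ) * (b : ℝ) ^ (θ - 1)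
      ≤ ((1 + 1 / (L : ℝ)) * b) * (1 + 1 / (L : ℝ)) ^ (2 - θ) / (1 - θ) * (b : ℝ) ^ (θ - 1) := by
        gcongr
    _ = _ := by ring

lemma le_stepOp_powObs_aux {θ : ℝ} (hθ : θ < 1) {L b : ℕ} (hL : 1 ≤ L) (hb : L ≤ b) {s : ℝ}
    (hs : s ∈ Icc (0 : ℝ) 1) :
    ENNReal.ofReal (((1 + 2 / (L : ℝ)) ^ 2)⁻¹ / (1 - θ)) * powObs θ b s ≤
      stepOp (powObs θ) b s := by
  have hb0 : (0 : ℝ) < b := by exact_mod_cast (by omega)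
  have hL0 : (0 : ℝ) < L := by exact_mod_cast (by omega)
  have h1θ : 0 < 1 - θ := by linarith
  rw [stepOp_apply]
  have key : ∀ j : ℕ, ENNReal.ofReal (b * ((1 + 2 / (L : ℝ)) ^ 2)⁻¹ / (1 - θ)) *
      ENNReal.ofReal (((b + j : ℕ) : ℝ) ^ (θ - 1) - (((b + j : ℕ) : ℝ) + 1) ^ (θ - 1)) ≤
      ENNReal.ofReal (transWeight b s (b + j)) * powObs θ (b + j) (nextSlope (b + j) s) := by
    intro j
    have hm : (0 : ℝ) < ((b + j : ℕ) : ℝ) := by exact_mod_cast (by omega)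
    have hLm : (L : ℝ) ≤ ((b + j : ℕ) : ℝ) := by exact_mod_cast (by omega)
    unfold powObs
    rw [← ENNReal.ofReal_mul (transWeight_nonneg _ _ hs.1), ← ENNReal.ofReal_mul (by positivity)]
    apply ENNReal.ofReal_le_ofReal
    set m : ℝ := ((b + j : ℕ) : ℝ) with hmdef
    have h1 := (rpow_sub_one_increment hθ hm).2
    have e1 : m + 2 ≤ (1 + 2 / (L : ℝ)) * m := by
      have : 1 ≤ m / L := by rw [one_le_div hL0]; exact hLm
      have e : (1 + 2 / (L : ℝ)) * m = m + 2 * (m / L) := by ring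
      linarith
    have h2 : b * ((1 + 2 / (L : ℝ)) ^ 2)⁻¹ / m ^ 2 ≤ transWeight b s (b + j) := by
      unfold transWeight
      rw [← hmdef]
      have := hs.1
      have := hs.2
      have e2 : (m + s) * (m + 1 + s) ≤ ((1 + 2 / (L : ℝ)) * m) ^ 2 := by
        calc (m + s) * (m + 1 + s) ≤ (m + 2) * (m + 2) := by apply mul_le_mul <;> linarith
          _ ≤ ((1 + 2 / (L : ℝ)) * m) * ((1 + 2 / (L : ℝ)) * m) := by gcongr
          _ = _ := by ring
      calc b * ((1 + 2 / (L : ℝ)) ^ 2)⁻¹ / m ^ 2 = b / ((1 + 2 / (L : ℝ)) * m) ^ 2 := by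
            field_simp
        _ ≤ (b + s) / ((m + s) * (m + 1 + s)) := by gcongr; linarith
    have h4 : m ^ θ = m ^ (θ - 2) * m ^ 2 := by
      rw [← Real.rpow_natCast, ← Real.rpow_add hm]; norm_num
    calc b * ((1 + 2 / (L : ℝ)) ^ 2)⁻¹ / (1 - θ) * (m ^ (θ - 1) - (m + 1) ^ (θ - 1))
        ≤ b * ((1 + 2 / (L : ℝ)) ^ 2)⁻¹ / (1 - θ) * ((1 - θ) * m ^ (θ - 2)) := by gcongr
      _ = b * ((1 + 2 / (L : ℝ)) ^ 2)⁻¹ / m ^ 2 * m ^ θ := by rw [h4]; field_simp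
      _ ≤ _ := by gcongr
  refine le_trans ?_ (ENNReal.tsum_le_tsum key)
  rw [ENNReal.tsum_mul_left, tsum_rpow_increment hθ (by omega)]
  unfold powObs
  rw [← ENNReal.ofReal_mul (by positivity), ← ENNReal.ofReal_mul (by positivity)]
  apply ENNReal.ofReal_le_ofReal
  have e3 : (b : ℝ) ^ θ = b ^ (θ - 1) * b := by
    rw [← Real.rpow_add_one hb0.ne']; ring_nf
  rw [e3]
  exact le_of_eq (by ring)

/-- From high levels the operator multiplies `m ^ θ` by at most any `c > 1 / (1 - θ)`. -/
lemma eventually_stepOp_powObs_le {θ c : ℝ} (hθ : θ < 1) (hc : 1 / (1 - θ) < c) :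
    ∀ᶠ L : ℕ in atTop, ∀ m, L ≤ m → ∀ s ∈ Icc (0 : ℝ) 1,
      stepOp (powObs θ) m s ≤ ENNReal.ofReal c * powObs θ m s := by
  have ht : Tendsto (fun L : ℕ => (1 + 1 / (L : ℝ)) ^ (3 - θ) / (1 - θ)) atTop
      (nhds ((1 + 0) ^ (3 - θ) / (1 - θ))) := by
    refine Tendsto.div_const (Tendsto.rpow_const ?_ (Or.inl (by norm_num))) _
    exact tendsto_const_nhds.add tendsto_one_div_atTop_nhds_zero_nat
  rw [add_zero, Real.one_rpow] at ht
  filter_upwards [ht.eventually (gt_mem_nhds hc), eventually_ge_atTop 1] with L hL hL1 m hm s hs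
  refine (stepOp_powObs_le_aux hθ hL1 hm hs).trans ?_
  gcongr

/-- From high levels the operator multiplies `m ^ θ` by at least any `c < 1 / (1 - θ)`. -/
lemma eventually_le_stepOp_powObs {θ c : ℝ} (hθ : θ < 1) (hc : c < 1 / (1 - θ)) :
    ∀ᶠ L : ℕ in atTop, ∀ m, L ≤ m → ∀ s ∈ Icc (0 : ℝ) 1,
      ENNReal.ofReal c * powObs θ m s ≤ stepOp (powObs θ) m s := by
  have ht : Tendsto (fun L : ℕ => ((1 + 2 / (L : ℝ)) ^ 2)⁻¹ / (1 - θ)) atTop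
      (nhds (((1 + 0) ^ 2)⁻¹ / (1 - θ))) := by
    refine Tendsto.div_const (Tendsto.inv₀ (Tendsto.pow ?_ 2) (by norm_num)) _
    exact tendsto_const_nhds.add (tendsto_const_div_atTop_nhds_zero_nat 2)
  have e : ((1 + 0 : ℝ) ^ 2)⁻¹ / (1 - θ) = 1 / (1 - θ) := by norm_num
  rw [e] at ht
  filter_upwards [ht.eventually (lt_mem_nhds hc), eventually_ge_atTop 1] with L hL hL1 m hm s hs
  refine le_trans ?_ (le_stepOp_powObs_aux hθ hL1 hm hs)
  gcongr

/-! ### From Lebesgue measure to the Markov chain -/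

/-- The conditional density on `(0, 1/b]` with parameter `s`. -/
noncomputable def condDensity (b : ℕ) (s y : ℝ) : ℝ := (b + s) / (1 + s * y) ^ 2

lemma measurable_firstQuotient : Measurable firstQuotient := by
  unfold firstQuotient; fun_prop

lemma measurable_ecfMap : Measurable ecfMap := by
  have h : Measurable fun x => (firstQuotient x : ℝ) :=
    measurable_from_top.comp measurable_firstQuotient
  unfold ecfMap; fun_prop

lemma measurable_partialQuotient (n : ℕ) : Measurable (partialQuotient n) :=
  measurable_firstQuotient.comp (measurable_ecfMap.iterate _)

lemma firstQuotient_inverseBranch {m : ℕ} (hm : 1 ≤ m) {z : ℝ} (hz : z ∈ Ico 0 (1 / (m : ℝ))) :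
    firstQuotient (1 / (m * (1 + z))) = m := by
  have hm0 : (0 : ℝ) < m := by exact_mod_cast hm
  have hz1 : z * m < 1 := (lt_div_iff₀ hm0).1 hz.2
  have hz0 := hz.1
  unfold firstQuotient
  rw [one_div_one_div, Nat.floor_eq_iff (by positivity)]
  constructor <;> nlinarith

lemma ecfMap_inverseBranch {m : ℕ} (hm : 1 ≤ m) {z : ℝ} (hz : z ∈ Ico 0 (1 / (m : ℝ))) :
    ecfMap (1 / (m * (1 + z))) = z := by
  have hm0 : (0 : ℝ) < m := by exact_mod_cast hm
  unfold ecfMap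
  rw [firstQuotient_inverseBranch hm hz, one_div_one_div]
  field_simp
  ring

lemma image_inverseBranch {m : ℕ} (hm : 1 ≤ m) :
    (fun z : ℝ => 1 / (m * (1 + z))) '' Ico 0 (1 / (m : ℝ)) =
      Ioc (1 / ((m : ℝ) + 1)) (1 / m) := by
  have hm0 : (0 : ℝ) < m := by exact_mod_cast hm
  ext y
  constructor
  · rintro ⟨z, hz, rfl⟩
    have hz1 : z * m < 1 := (lt_div_iff₀ hm0).1 hz.2
    have hz0 := hz.1
    constructor
    · exact one_div_lt_one_div_of_lt (by positivity) (by nlinarith)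
    · exact one_div_le_one_div_of_le hm0 (by nlinarith)
  · rintro ⟨h1, h2⟩
    have hy : 0 < y := lt_trans (by positivity) h1
    have h1' : 1 / y < m + 1 := by
      rw [div_lt_iff₀ hy]; rw [div_lt_iff₀ (by positivity)] at h1; linarith
    have h2' : (m : ℝ) ≤ 1 / y := by
      rw [le_div_iff₀ hy]; rw [le_div_iff₀ hm0] at h2; linarith
    refine ⟨1 / y / m - 1, ⟨?_, ?_⟩, ?_⟩
    · rw [sub_nonneg, le_div_iff₀ hm0]; linarith
    · rw [sub_lt_iff_lt_add, show 1 / (m : ℝ) + 1 = (m + 1) / m by field_simp; ring]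
      exact div_lt_div_of_pos_right h1' hm0
    · simp only
      field_simp
      ring

/-- Substitute `y = 1 / (m (1 + z))`, which inverts the map on the cell where the first quotient is
`m`. The density times the Jacobian is again of the family, up to the mass `transWeight b s m` of
the cell. -/
lemma lintegral_cell {b m : ℕ} (hm : 1 ≤ m) {s : ℝ} (hs : 0 ≤ s)
    (H : ℕ → ℝ → ℝ≥0∞) :
    ∫⁻ y in Ioc (1 / ((m : ℝ) + 1)) (1 / m),
        ENNReal.ofReal (condDensity b s y) * H (firstQuotient y) (ecfMap y) =
      ENNReal.ofReal (transWeight b s m) *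
        ∫⁻ z in Ioc 0 (1 / (m : ℝ)), ENNReal.ofReal (condDensity m (nextSlope m s) z) * H m z := by
  have hm0 : (0 : ℝ) < m := by exact_mod_cast hm
  rw [← image_inverseBranch hm, lintegral_image_eq_lintegral_abs_deriv_mul
    (f' := fun z => -(m : ℝ) / (m * (1 + z)) ^ 2) measurableSet_Ico]
  · rw [← lintegral_const_mul' _ _ ENNReal.ofReal_ne_top,
      setLIntegral_congr (Ioc_ae_eq_Icc.trans Ico_ae_eq_Icc.symm)]
    refine setLIntegral_congr_fun measurableSet_Ico fun z hz => ?_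
    have hz0 := hz.1
    simp only [firstQuotient_inverseBranch hm hz, ecfMap_inverseBranch hm hz]
    rw [← mul_assoc, ← mul_assoc, ← ENNReal.ofReal_mul (abs_nonneg _),
      ← ENNReal.ofReal_mul (transWeight_nonneg _ _ hs)]
    congr 2
    rw [abs_div, abs_neg, abs_of_pos hm0, abs_of_nonneg (by positivity)]
    unfold condDensity transWeight nextSlope
    have h1 : 0 < 1 + z := by linarith
    have h2 : 0 < (m : ℝ) + s := by linarith
    have h3 : 0 < (m : ℝ) + 1 + s := by linarith
    have h4 : 0 < (m : ℝ) * (1 + z) + s := by positivity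
    have e1 : 1 + s * (1 / (m * (1 + z))) = (m * (1 + z) + s) / (m * (1 + z)) := by field_simp
    have e2 : 1 + (m : ℝ) / (m + s) * z = (m * (1 + z) + s) / (m + s) := by field_simp; ring
    have e3 : (m : ℝ) + m / (m + s) = m * (m + 1 + s) / (m + s) := by field_simp; ring
    rw [e1, e2, e3]
    field_simp
  · intro z hz
    have h1 : 0 < 1 + z := by linarith [hz.1]
    have h2 : (m : ℝ) * (1 + z) ≠ 0 := by positivity
    have h3 : HasDerivAt (fun z : ℝ => (m : ℝ) * (1 + z)) m z := by
      simpa using ((hasDerivAt_id z).const_add 1).const_mul (m : ℝ)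
    have := h3.inv h2
    simp only [one_div]
    exact this.hasDerivWithinAt
  · intro x hx y hy hxy
    have := congrArg ecfMap hxy
    simpa only [ecfMap_inverseBranch hm hx, ecfMap_inverseBranch hm hy] using this

lemma iUnion_cells {b : ℕ} (hb : 1 ≤ b) :
    ⋃ j : ℕ, Ioc (1 / (((b + j : ℕ) : ℝ) + 1)) (1 / ((b + j : ℕ) : ℝ)) = Ioc 0 (1 / (b : ℝ)) := by
  have hb0 : (0 : ℝ) < b := by exact_mod_cast hb
  ext y
  simp only [mem_iUnion, mem_Ioc]
  constructor
  · rintro ⟨j, h1, h2⟩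
    refine ⟨lt_trans (by positivity) h1, h2.trans ?_⟩
    exact one_div_le_one_div_of_le hb0 (by push_cast; linarith [(Nat.cast_nonneg j : (0 : ℝ) ≤ j)])
  · rintro ⟨h0, h1⟩
    have hby : (b : ℝ) ≤ 1 / y := by
      rw [le_div_iff₀ h0]; rw [le_div_iff₀ hb0] at h1; linarith
    have hbf : b ≤ ⌊1 / y⌋₊ := Nat.le_floor hby
    refine ⟨⌊1 / y⌋₊ - b, ?_⟩
    rw [Nat.add_sub_cancel' hbf]
    have hf0 : (0 : ℝ) < (⌊1 / y⌋₊ : ℝ) := by exact_mod_cast (by omega)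
    constructor
    · rw [one_div_lt (by positivity) h0]; exact Nat.lt_floor_add_one _
    · rw [le_one_div h0 hf0]; exact Nat.floor_le (by positivity)

lemma pairwise_disjoint_cells {b : ℕ} (hb : 1 ≤ b) :
    Pairwise (Function.onFun Disjoint
      fun j : ℕ => Ioc (1 / (((b + j : ℕ) : ℝ) + 1)) (1 / ((b + j : ℕ) : ℝ))) := by
  have hb0 : (0 : ℝ) < b := by exact_mod_cast hb
  have h : Antitone fun j : ℕ => 1 / ((b + j : ℕ) : ℝ) := by
    intro i j hij
    refine one_div_le_one_div_of_le (by push_cast; positivity) ?_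
    exact_mod_cast (by omega)
  convert h.pairwise_disjoint_on_Ioc_succ using 5
  simp [Order.succ_eq_add_one, add_assoc]

lemma lintegral_condDensity_eq_tsum {b : ℕ} (hb : 1 ≤ b) {s : ℝ} (hs : 0 ≤ s)
    (H : ℕ → ℝ → ℝ≥0∞) :
    ∫⁻ y in Ioc 0 (1 / (b : ℝ)),
        ENNReal.ofReal (condDensity b s y) * H (firstQuotient y) (ecfMap y) =
      ∑' j : ℕ, ENNReal.ofReal (transWeight b s (b + j)) *
        ∫⁻ z in Ioc 0 (1 / ((b + j : ℕ) : ℝ)),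
          ENNReal.ofReal (condDensity (b + j) (nextSlope (b + j) s) z) * H (b + j) z := by
  rw [← iUnion_cells hb, lintegral_iUnion (fun _ => measurableSet_Ioc) (pairwise_disjoint_cells hb)]
  exact tsum_congr fun j => lintegral_cell (by omega) hs H

lemma lintegral_condDensity {b : ℕ} (hb : 1 ≤ b) {s : ℝ} (hs : 0 ≤ s) :
    ∫⁻ y in Ioc 0 (1 / (b : ℝ)), ENNReal.ofReal (condDensity b s y) = 1 := by
  have hb0 : (0 : ℝ) < b := by exact_mod_cast hb
  have hle : (0 : ℝ) ≤ 1 / b := by positivity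
  have hpos : ∀ y ∈ Icc (0 : ℝ) (1 / b), 0 < 1 + s * y := fun y hy => by
    have := mul_nonneg hs hy.1; linarith
  have hcont : ContinuousOn (condDensity b s) (Icc 0 (1 / b)) := by
    unfold condDensity
    exact ContinuousOn.div (by fun_prop) (by fun_prop) fun y hy => (pow_pos (hpos y hy) 2).ne'
  have hint : IntegrableOn (condDensity b s) (Ioc 0 (1 / b)) :=
    (hcont.integrableOn_Icc).mono_set Ioc_subset_Icc_self
  rw [← ofReal_integral_eq_lintegral_ofReal hint (ae_of_all _ fun y => by
    unfold condDensity; positivity), ← intervalIntegral.integral_of_le hle]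
  rw [intervalIntegral.integral_eq_sub_of_hasDerivAt (f := fun y => (b + s) * y / (1 + s * y))]
  · have : (b : ℝ) + s ≠ 0 := by positivity
    have e : (b + s) * (1 / (b : ℝ)) / (1 + s * (1 / b)) - (b + s) * 0 / (1 + s * 0) = 1 := by
      field_simp; ring
    rw [e, ENNReal.ofReal_one]
  · intro y hy
    rw [uIcc_of_le hle] at hy
    have h1 : HasDerivAt (fun y : ℝ => (b + s) * y) (b + s) y := by
      simpa using (hasDerivAt_id y).const_mul ((b : ℝ) + s)
    have h2 : HasDerivAt (fun y : ℝ => 1 + s * y) s y := by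
      simpa using ((hasDerivAt_id y).const_mul s).const_add 1
    refine (h1.div h2 (hpos y hy).ne').congr_deriv ?_
    unfold condDensity
    congr 1
    ring
  · rw [intervalIntegrable_iff_integrableOn_Ioc_of_le hle]; exact hint

lemma lintegral_condDensity_iterate (f : ℕ → ℝ≥0∞) (n : ℕ) :
    ∀ {b : ℕ}, 1 ≤ b → ∀ {s : ℝ}, s ∈ Icc (0 : ℝ) 1 →
    ∫⁻ y in Ioc 0 (1 / (b : ℝ)),
        ENNReal.ofReal (condDensity b s y) * f (firstQuotient (ecfMap^[n] y)) =
      (stepOp ^ (n + 1)) (fun m _ => f m) b s := by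
  induction n with
  | zero =>
    intro b hb s hs
    have := lintegral_condDensity_eq_tsum hb hs.1 (fun m _ => f m)
    simp only [Function.iterate_zero, id, this, zero_add, pow_one, stepOp_apply]
    refine tsum_congr fun j => ?_
    rw [lintegral_mul_const _ (by unfold condDensity; fun_prop), lintegral_condDensity (by omega) (nextSlope_mem _ hs).1,
      one_mul]
  | succ n ih =>
    intro b hb s hs
    have := lintegral_condDensity_eq_tsum hb hs.1 (fun _ z => f (firstQuotient (ecfMap^[n] z)))
    simp only [Function.iterate_succ, Function.comp_apply]
    rw [this, stepOp_pow_succ, stepOp_apply]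
    exact tsum_congr fun j => by rw [ih (by omega) (nextSlope_mem _ hs)]

/-- The law of the `n`-th partial quotient under Lebesgue measure in terms of the Markov chain
started at level `1` with slope `0`. -/
lemma lebesgueUnit_partialQuotient (A : Set ℕ) {n : ℕ} (hn : 1 ≤ n) :
    lebesgueUnit {x | partialQuotient n x ∈ A} =
      (stepOp ^ n) (fun m _ => A.indicator 1 m) 1 0 := by
  have hm : MeasurableSet {x | partialQuotient n x ∈ A} :=
    measurable_partialQuotient n (MeasurableSet.of_discrete (s := A))
  rw [← lintegral_indicator_one hm, lebesgueUnit]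
  -- At level `1` and slope `0` the conditional density is the constant `1` on `(0, 1]`.
  have := lintegral_condDensity_iterate (A.indicator 1) (n - 1) le_rfl (s := 0) (by simp)
  rw [Nat.sub_add_cancel hn] at this
  rw [← this]
  simp only [condDensity, Nat.cast_one, add_zero, zero_mul, one_pow, div_one, ENNReal.ofReal_one,
    one_mul]
  rfl

/-! ### Low levels and the moment upper bound -/

lemma transWeight_self {b : ℕ} (hb : 1 ≤ b) {s : ℝ} (hs : 0 ≤ s) :
    transWeight b s b = 1 / (b + 1 + s) := by
  have hb0 : (0 : ℝ) < b := by exact_mod_cast hb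
  unfold transWeight
  field_simp

/-- For a fixed target the weight increases with the starting level, so the moves that leave `b` are
dominated by a full step from `b + 1`. -/
lemma stepOp_le_stay_add (V : ℕ → ℝ → ℝ≥0∞) {b : ℕ} (hb : 1 ≤ b) {s : ℝ} (hs : 0 ≤ s) :
    stepOp V b s ≤
      ENNReal.ofReal (1 / (b + 1 + s)) * V b (nextSlope b s) + stepOp V (b + 1) s := by
  rw [stepOp_apply, stepOp_apply, tsum_eq_zero_add' ENNReal.summable]
  refine add_le_add (by rw [add_zero, transWeight_self hb hs]) (ENNReal.tsum_le_tsum fun j => ?_)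
  rw [show b + (j + 1) = b + 1 + j by ring]
  gcongr
  unfold transWeight
  gcongr
  linarith

lemma stay_le_stepOp (V : ℕ → ℝ → ℝ≥0∞) {b : ℕ} (hb : 1 ≤ b) {s : ℝ} (hs : 0 ≤ s) :
    ENNReal.ofReal (1 / (b + 1 + s)) * V b (nextSlope b s) ≤ stepOp V b s := by
  have := ENNReal.le_tsum
    (f := fun j => ENNReal.ofReal (transWeight b s (b + j)) * V (b + j) (nextSlope (b + j) s)) 0
  rw [stepOp_apply, ← transWeight_self hb hs]
  simpa using this

/-- A dominating supermartingale weight on the levels `m ≥ 2`. -/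
lemma exists_weight {θ c : ℝ} (hθ : θ < 1) (hc : 1 / (1 - θ) < c) (hc3 : 1 / 3 < c) :
    ∃ w : ℕ → ℝ, (∀ m : ℕ, (m : ℝ) ^ θ ≤ w m) ∧ ∀ m, 2 ≤ m → ∀ s ∈ Icc (0 : ℝ) 1,
      stepOp (fun m _ => ENNReal.ofReal (w m)) m s ≤ ENNReal.ofReal (c * w m) := by
  obtain ⟨L, hL⟩ := (eventually_stepOp_powObs_le hθ hc).exists
  have hc0 : 0 < c := by linarith
  -- Downward induction from `L`: each step raises the weight at one more level, which leaves the
  -- inequality at the levels above it untouched.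
  have claim : ∀ d : ℕ, ∃ w : ℕ → ℝ, (∀ m : ℕ, (m : ℝ) ^ θ ≤ w m) ∧
      ∀ m, 2 ≤ m → L ≤ m + d → ∀ s ∈ Icc (0 : ℝ) 1,
        stepOp (fun m _ => ENNReal.ofReal (w m)) m s ≤ ENNReal.ofReal (c * w m) := by
    intro d
    induction d with
    | zero =>
      refine ⟨fun m => (m : ℝ) ^ θ, fun m => le_rfl, fun m _ hm s hs => ?_⟩
      rw [ENNReal.ofReal_mul hc0.le]
      exact hL m (by omega) s hs
    | succ d ih =>
      obtain ⟨w, hw, hw'⟩ := ih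
      rcases lt_or_ge L (d + 3) with hd | hd
      · exact ⟨w, hw, fun m h2 _ s hs => hw' m h2 (by omega) s hs⟩
      obtain ⟨j, rfl⟩ : ∃ j, L = j + (d + 1) := ⟨L - (d + 1), by omega⟩
      have hj : 2 ≤ j := by omega
      -- The second entry makes `v / 3 + c * w (j + 1) ≤ c * v`, where `1/3` bounds the probability
      -- of staying at a level `≥ 2`.
      set v : ℝ := max (w j) (c * w (j + 1) / (c - 1 / 3)) with hv
      have hwnn : ∀ m, 0 ≤ w m := fun m => (by positivity : (0 : ℝ) ≤ (m : ℝ) ^ θ).trans (hw m)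
      have hvnn : 0 ≤ v := (hwnn j).trans (le_max_left _ _)
      have habove : ∀ m, j + 1 ≤ m → ∀ s ∈ Icc (0 : ℝ) 1,
          stepOp (fun m _ => ENNReal.ofReal (Function.update w j v m)) m s ≤
            ENNReal.ofReal (c * w m) := by
        intro m hm s hs
        refine le_trans (stepOp_mono (L := j + 1) ?_ hm hs) (hw' m (by omega) (by omega) s hs)
        intro k hk _ _
        simp [Function.update_of_ne (show k ≠ j by omega)]
      refine ⟨Function.update w j v, fun m => ?_, fun m h2 hm s hs => ?_⟩
      · rcases eq_or_ne m j with rfl | h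
        · rw [Function.update_self]; exact (hw m).trans (le_max_left _ _)
        · simpa [h] using hw m
      · rcases Nat.lt_or_ge j m with h | h
        · simpa [Function.update_of_ne h.ne'] using habove m h s hs
        obtain rfl : m = j := by omega
        refine (stepOp_le_stay_add _ (by omega) hs.1).trans ?_
        refine (add_le_add_right (habove (m + 1) le_rfl s hs) _).trans ?_
        have := hs.1
        simp only [Function.update_self]
        rw [← ENNReal.ofReal_mul (by positivity), ← ENNReal.ofReal_add (by positivity)
          (mul_nonneg hc0.le (hwnn _))]
        apply ENNReal.ofReal_le_ofReal
        have h1 : c * w (m + 1) / (c - 1 / 3) ≤ v := le_max_right _ _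
        rw [div_le_iff₀ (by linarith)] at h1
        have hm2 : (2 : ℝ) ≤ m := by exact_mod_cast hj
        have h2 : 1 / ((m : ℝ) + 1 + s) ≤ 1 / 3 :=
          one_div_le_one_div_of_le (by norm_num) (by linarith)
        nlinarith [mul_le_mul_of_nonneg_right h2 hvnn]
  obtain ⟨w, hw, hw'⟩ := claim L
  exact ⟨w, hw, fun m h2 s hs => hw' m h2 (by omega) s hs⟩

/-- Eigenfunction of the transition restricted to the level `1`, with eigenvalue
`(1 + φ)⁻¹`. -/
noncomputable def stayEigen (s : ℝ) : ℝ := (1 + s) / (s + φ) ^ 2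

/-- At level 1 the slope moves by `s ↦ 1 / (1 + s)`. Its fixed point `-φ` turns `s + φ` into `φ (s +
φ) / (1 + s)`, while `1 + s` becomes `(2 + s) / (1 + s)`, which cancels the staying probability. -/
lemma stayEigen_nextSlope {s : ℝ} (hs : 0 ≤ s) :
    1 / (2 + s) * stayEigen (nextSlope 1 s) = 1 / (1 + φ) * stayEigen s := by
  have hφ := Real.goldenRatio_pos
  have hφ2 := Real.goldenRatio_sq
  have h1 : 0 < 1 + s := by linarith
  have h2 : 0 < s + φ := by linarith
  have e1 : nextSlope 1 s + φ = φ * (s + φ) / (1 + s) := by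
    unfold nextSlope
    rw [eq_div_iff h1.ne', Nat.cast_one, add_mul, div_mul_cancel₀ _ h1.ne']
    linear_combination -hφ2
  have e2 : 1 + nextSlope 1 s = (2 + s) / (1 + s) := by
    unfold nextSlope; push_cast; field_simp; ring
  unfold stayEigen
  rw [e1, e2, ← hφ2.trans (add_comm _ _)]
  field_simp

lemma stayEigen_ge {s : ℝ} (hs : s ∈ Icc (0 : ℝ) 1) : 1 / 9 ≤ stayEigen s := by
  have hφ := Real.goldenRatio_pos
  have := Real.goldenRatio_lt_two
  have := hs.1
  have := hs.2
  unfold stayEigen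
  rw [div_le_div_iff₀ (by norm_num) (by positivity)]
  nlinarith

lemma stayEigen_le {s : ℝ} (hs : s ∈ Icc (0 : ℝ) 1) : stayEigen s ≤ 2 := by
  have := Real.one_lt_goldenRatio
  have := hs.1
  have := hs.2
  unfold stayEigen
  rw [div_le_iff₀ (by positivity)]
  nlinarith

/-- The moments of the partial quotients grow at most like `(1 - θ) ^ (-n)` as long as
`-φ < θ < 1`. -/
lemma exists_stepOp_pow_powObs_le {θ c : ℝ} (hθ' : -φ < θ) (hθ : θ < 1) (hc : 1 / (1 - θ) < c) :
    ∃ C : ℝ, 0 < C ∧ ∀ n, (stepOp ^ n) (powObs θ) 1 0 ≤ ENNReal.ofReal (C * c ^ n) := by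
  have hφ0 := Real.goldenRatio_pos
  have hφ2 := Real.goldenRatio_lt_two
  -- Here `-φ < θ` is decisive: waiting at level 1 costs more than `c` allows.
  have hcφ : 1 / (1 + φ) < c :=
    lt_trans (one_div_lt_one_div_of_lt (by linarith) (by linarith)) hc
  have hc3 : 1 / 3 < c :=
    lt_trans (one_div_lt_one_div_of_lt (by linarith) (by linarith)) hcφ
  have hc0 : 0 < c := by linarith
  obtain ⟨w, hw, hw'⟩ := exists_weight hθ hc hc3
  have hwnn : ∀ m, 0 ≤ w m := fun m => (by positivity : (0 : ℝ) ≤ (m : ℝ) ^ θ).trans (hw m)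
  -- With `stayEigen ≥ 1/9`, the entry `9` makes the weight at level 1 at least `1`; the other makes
  -- the surplus `K * (c - 1 / (1 + φ)) * stayEigen s` absorb the moves out of level 1.
  set K : ℝ := max 9 (9 * (c * w 2) / (c - 1 / (1 + φ))) with hK
  have hK9 : 9 ≤ K := le_max_left _ _
  have hKw : 9 * (c * w 2) ≤ K * (c - 1 / (1 + φ)) := by
    rw [← div_le_iff₀ (by linarith)]; exact le_max_right _ _
  set V : ℕ → ℝ → ℝ≥0∞ :=
    fun m s => ENNReal.ofReal (if m = 1 then K * stayEigen s else w m) with hV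
  have hV2 : ∀ m, 2 ≤ m → ∀ s ∈ Icc (0 : ℝ) 1, stepOp V m s ≤ ENNReal.ofReal (c * w m) := by
    intro m hm s hs
    refine le_trans (stepOp_mono (L := 2) ?_ hm hs) (hw' m hm s hs)
    intro k hk _ _
    simp [hV, show k ≠ 1 by omega]
  have hVstep : ∀ m, 1 ≤ m → ∀ s ∈ Icc (0 : ℝ) 1, stepOp V m s ≤ ENNReal.ofReal c * V m s := by
    intro m hm s hs
    rw [hV]
    simp only
    rw [← ENNReal.ofReal_mul hc0.le]
    rcases Nat.lt_or_ge 1 m with h | h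
    · simpa [h.ne'] using hV2 m h s hs
    obtain rfl : m = 1 := by omega
    have hs0 := hs.1
    have hg := stayEigen_ge hs
    have hg' := stayEigen_ge (nextSlope_mem 1 hs)
    refine (stepOp_le_stay_add _ le_rfl hs.1).trans ?_
    refine (add_le_add_right (hV2 2 le_rfl s hs) _).trans ?_
    simp only [if_true]
    rw [← ENNReal.ofReal_mul (by positivity), ← ENNReal.ofReal_add
      (by positivity) (mul_nonneg hc0.le (hwnn _))]
    apply ENNReal.ofReal_le_ofReal
    have e := stayEigen_nextSlope hs.1
    have e' : 1 / ((1 : ℕ) + 1 + s) * (K * stayEigen (nextSlope 1 s)) =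
        K * (1 / (1 + φ) * stayEigen s) := by
      rw [← e]; push_cast; ring
    rw [e']
    have h3 : 0 ≤ K * (c - 1 / (1 + φ)) := mul_nonneg (by linarith) (by linarith)
    nlinarith [mul_le_mul_of_nonneg_left hg h3]
  have hVge : ∀ m, 1 ≤ m → ∀ s ∈ Icc (0 : ℝ) 1, powObs θ m s ≤ V m s := by
    intro m hm s hs
    apply ENNReal.ofReal_le_ofReal
    rcases Nat.lt_or_ge 1 m with h | h
    · simpa [h.ne'] using hw m
    obtain rfl : m = 1 := by omega
    have hg := stayEigen_ge hs
    simp only [if_true, Nat.cast_one, Real.one_rpow]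
    nlinarith
  have h0 : (0 : ℝ) ∈ Icc (0 : ℝ) 1 := by simp
  have hg := stayEigen_ge h0
  refine ⟨K * stayEigen 0, by positivity, fun n => ?_⟩
  refine (stepOp_pow_mono hVge n 1 le_rfl 0 h0).trans ?_
  refine (stepOp_pow_le hVstep n 1 le_rfl 0 h0).trans (le_of_eq ?_)
  simp only [if_true, hV]
  rw [← ENNReal.ofReal_pow hc0.le, ← ENNReal.ofReal_mul (by positivity), mul_comm]

/-! ### Lower bounds: waiting, jumping and growing -/

/-- Staying at level `1` for `k` steps costs a factor `(1 + φ) ^ (-k)`. -/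
lemma le_stepOp_pow_stay (f : ℕ → ℝ → ℝ≥0∞) {a : ℝ≥0∞}
    (hf : ∀ s ∈ Icc (0 : ℝ) 1, a ≤ f 1 s) (k : ℕ) : ∀ s ∈ Icc (0 : ℝ) 1,
      ENNReal.ofReal ((1 / (1 + φ)) ^ k * stayEigen s / 2) * a ≤ (stepOp ^ k) f 1 s := by
  have hφ0 := Real.goldenRatio_pos
  induction k with
  | zero =>
    intro s hs
    refine le_trans ?_ (hf s hs)
    have h2 := stayEigen_le hs
    calc _ ≤ ENNReal.ofReal 1 * a := by gcongr; linarith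
      _ = a := by simp
  | succ k ih =>
    intro s hs
    have hs0 := hs.1
    rw [stepOp_pow_succ]
    refine le_trans ?_ (stay_le_stepOp _ le_rfl hs.1)
    refine le_trans ?_ (mul_le_mul_right (ih _ (nextSlope_mem 1 hs)) _)
    rw [← mul_assoc, ← ENNReal.ofReal_mul (by positivity)]
    have e := stayEigen_nextSlope hs.1
    have e' : 1 / ((1 : ℕ) + 1 + s) * ((1 / (1 + φ)) ^ k * stayEigen (nextSlope 1 s) / 2) =
        (1 / (1 + φ)) ^ (k + 1) * stayEigen s / 2 := by
      rw [pow_succ, mul_assoc ((1 / (1 + φ)) ^ k), ← e]; push_cast; ring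
    rw [e']

/-- Levels `m` with `|log m - N v| ≤ N δ`. -/
def logWindow (N : ℕ) (v δ : ℝ) : Set ℕ := {m | |Real.log m - N * v| ≤ N * δ}

lemma powObs_eq_exp {θ : ℝ} {m : ℕ} (hm : 1 ≤ m) (s : ℝ) :
    powObs θ m s = ENNReal.ofReal (Real.exp (θ * Real.log m)) := by
  have hm0 : (0 : ℝ) < m := by exact_mod_cast hm
  rw [powObs, Real.rpow_def_of_pos hm0, mul_comm]

/-- Outside the window, `m ^ θ` is dominated by the power `θ + η` if `m` is too large and by `θ - η`
if it is too small, with an exponentially small factor relative to `exp (± N η v)`. -/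
lemma powObs_le_window {θ η v δ : ℝ} (hη : 0 ≤ η) (N : ℕ) {m : ℕ} (hm : 1 ≤ m) (s : ℝ) :
    powObs θ m s ≤
      ENNReal.ofReal (Real.exp (θ * v + |θ| * δ) ^ N) * (logWindow N v δ).indicator 1 m +
      (ENNReal.ofReal (Real.exp (-(η * (v + δ))) ^ N) * powObs (θ + η) m s +
       ENNReal.ofReal (Real.exp (η * (v - δ)) ^ N) * powObs (θ - η) m s) := by
  simp only [powObs_eq_exp hm, ← Real.exp_nat_mul]
  by_cases h : m ∈ logWindow N v δ
  · refine le_trans ?_ le_self_add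
    rw [indicator_of_mem h, Pi.one_apply, mul_one]
    apply ENNReal.ofReal_le_ofReal
    apply Real.exp_le_exp.2
    have h1 : θ * (Real.log m - N * v) ≤ |θ| * (N * δ) :=
      (le_abs_self _).trans (by rw [abs_mul]; exact mul_le_mul_of_nonneg_left h (abs_nonneg _))
    linarith
  · refine le_trans ?_ le_add_self
    have h' : N * δ < |Real.log m - N * v| := not_le.1 h
    rw [← ENNReal.ofReal_mul (Real.exp_nonneg _), ← ENNReal.ofReal_mul (Real.exp_nonneg _),
      ← Real.exp_add, ← Real.exp_add]
    rcases lt_abs.1 h' with h1 | h1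
    · refine le_trans (ENNReal.ofReal_le_ofReal (Real.exp_le_exp.2 ?_)) le_self_add
      nlinarith
    · refine le_trans (ENNReal.ofReal_le_ofReal (Real.exp_le_exp.2 ?_)) le_add_self
      nlinarith

lemma exp_neg_lt_one_sub {z y : ℝ} (hz : z ≤ 1 / 2) (h : z + 2 * z ^ 2 < y) :
    Real.exp (-y) < 1 - z := by
  rw [← Real.lt_log_iff_exp_lt (by linarith)]
  have h1 := Real.one_sub_inv_le_log_of_pos (show 0 < 1 - z by linarith)
  have h2 : -(z + 2 * z ^ 2) ≤ 1 - (1 - z)⁻¹ := by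
    have h3 : (1 - z)⁻¹ ≤ 1 + z + 2 * z ^ 2 := by
      rw [inv_le_iff_one_le_mul₀ (by linarith)]
      nlinarith [mul_nonneg (sq_nonneg z) (show 0 ≤ 1 - 2 * z by linarith)]
    linarith
  linarith

lemma eventually_mul_pow_le {r c C D : ℝ} (hr : 0 ≤ r) (hrc : r < c) (hC : 0 < C) :
    ∀ᶠ N : ℕ in atTop, r ^ N * D ≤ C * c ^ N := by
  have hc : 0 < c := by linarith
  have ht : Tendsto (fun N : ℕ => (r / c) ^ N * D) atTop (nhds (0 * D)) :=
    (tendsto_pow_atTop_nhds_zero_of_lt_one (by positivity) ((div_lt_one hc).2 hrc)).mul_const D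
  rw [zero_mul] at ht
  filter_upwards [ht.eventually (gt_mem_nhds hC)] with N hN
  rw [div_pow, div_mul_eq_mul_div, div_lt_iff₀ (by positivity)] at hN
  exact hN.le

/-- A change of measure carried out on moments. The choice `θ = 1 - 1/v` makes `v` the derivative of
`-log (1 - θ)`, hence the typical speed under the tilt. The `θ`-moment grows nearly like `v ^ N`,
its part outside the window at a strictly smaller rate, so the window carries the rest. Dividing by
`exp (N θ v)`, with `θ v = v - 1`, gives the probability. -/
lemma growth_from_high_level_aux {v δ ζ : ℝ} (hv : 0 < v) (hδ : 0 < δ) (hζ : 0 < ζ)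
    (hδζ : |1 - 1 / v| * δ ≤ ζ / 4) :
    ∃ L : ℕ, 1 ≤ L ∧ ∀ᶠ N : ℕ in atTop, ∀ s ∈ Icc (0 : ℝ) 1,
      ENNReal.ofReal (Real.exp (-(v - 1 - Real.log v + ζ)) ^ N) ≤
        (stepOp ^ N) (fun m _ => (logWindow N v δ).indicator 1 m) L s := by
  set θ : ℝ := 1 - 1 / v with hθdef
  -- The first bound gives `η v ≤ 1/2`, hence `θ + η < 1`; the second makes the gain `η δ` exceed
  -- the second-order loss `2 (η v) ^ 2`.
  set η : ℝ := min (1 / (2 * v)) (δ / (4 * v ^ 2)) with hηdef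
  have hη : 0 < η := by positivity
  have hηv : η * v ≤ 1 / 2 := by
    calc η * v ≤ 1 / (2 * v) * v := by gcongr; exact min_le_left _ _
      _ = 1 / 2 := by field_simp
  have hηδ : 4 * (η * v ^ 2) ≤ δ := by
    calc 4 * (η * v ^ 2) ≤ 4 * (δ / (4 * v ^ 2) * v ^ 2) := by gcongr; exact min_le_right _ _
      _ = δ := by field_simp
  have hv1 : 1 / v * v = 1 := by field_simp
  have hθ1 : 1 - θ = 1 / v := by rw [hθdef]; ring
  have hp : (1 - (θ + η)) * v = 1 - η * v := by rw [hθdef]; linear_combination hv1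
  have hm : (1 - (θ - η)) * v = 1 + η * v := by rw [hθdef]; linear_combination hv1
  have hθlt : θ < 1 := by have : 0 < 1 / v := by positivity
                          linarith
  have hplt : θ + η < 1 := by
    have : 0 < (1 - (θ + η)) * v := by rw [hp]; linarith
    have := pos_of_mul_pos_left this hv.le
    linarith
  have hmlt : θ - η < 1 := by linarith
  have hv2 : (η * v) ^ 2 * 4 ≤ η * δ := by nlinarith
  have hηδ0 : 0 < η * δ := by positivity
  have hz0 : 0 < η * v := by positivity
  have hA : Real.exp (-(η * (v + δ))) * (1 / (1 - (θ + η))) < v := by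
    rw [mul_one_div, div_lt_iff₀ (by linarith), mul_comm v, hp]
    exact exp_neg_lt_one_sub hηv (by nlinarith)
  have hB : Real.exp (η * (v - δ)) * (1 / (1 - (θ - η))) < v := by
    rw [mul_one_div, div_lt_iff₀ (by linarith), mul_comm v, hm]
    have := exp_neg_lt_one_sub (z := -(η * v)) (y := -(η * (v - δ))) (by linarith) (by nlinarith)
    simpa using this
  have hC : v * Real.exp (-(ζ / 4)) < v := by
    have : Real.exp (-(ζ / 4)) < 1 := Real.exp_lt_one_iff.2 (by linarith)
    nlinarith
  obtain ⟨c, hc, hcv⟩ := exists_between (max_lt (max_lt hA hB) hC)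
  have hcA := ((le_max_left _ _).trans (le_max_left _ _)).trans_lt hc
  have hcB := ((le_max_right _ _).trans (le_max_left _ _)).trans_lt hc
  have hcC := (le_max_right _ _).trans_lt hc
  have hc0 : 0 < c := lt_trans (by positivity) hcC
  obtain ⟨cp, hcp, hcp'⟩ : ∃ cp, 1 / (1 - (θ + η)) < cp ∧
      Real.exp (-(η * (v + δ))) * cp < c := by
    obtain ⟨cp, h1, h2⟩ := exists_between ((lt_div_iff₀' (Real.exp_pos _)).2 hcA)
    exact ⟨cp, h1, (lt_div_iff₀' (Real.exp_pos _)).1 h2⟩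
  obtain ⟨cm, hcm, hcm'⟩ : ∃ cm, 1 / (1 - (θ - η)) < cm ∧
      Real.exp (η * (v - δ)) * cm < c := by
    obtain ⟨cm, h1, h2⟩ := exists_between ((lt_div_iff₀' (Real.exp_pos _)).2 hcB)
    exact ⟨cm, h1, (lt_div_iff₀' (Real.exp_pos _)).1 h2⟩
  have hcp0 : 0 < cp := lt_trans (one_div_pos.2 (by linarith)) hcp
  have hcm0 : 0 < cm := lt_trans (one_div_pos.2 (by linarith)) hcm
  have hcv' : c < 1 / (1 - θ) := by rw [hθ1, one_div_one_div]; exact hcv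
  obtain ⟨L, hL0, hLp, hLm, hL1⟩ := ((eventually_le_stepOp_powObs hθlt hcv').and
    ((eventually_stepOp_powObs_le hplt hcp).and ((eventually_stepOp_powObs_le hmlt hcm).and
      (eventually_ge_atTop 1)))).exists
  have hLpos : (0 : ℝ) < L := by exact_mod_cast hL1
  have hX : 0 < (L : ℝ) ^ θ := by positivity
  refine ⟨L, hL1, ?_⟩
  -- Each tail takes at most a quarter of `L ^ θ * c ^ N`, so half remains for the window; the third
  -- estimate absorbs the constant `L ^ θ / 2`.
  filter_upwards [eventually_mul_pow_le (D := (L : ℝ) ^ (θ + η)) (C := (L : ℝ) ^ θ / 4)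
      (by positivity) hcp' (by positivity),
    eventually_mul_pow_le (D := (L : ℝ) ^ (θ - η)) (C := (L : ℝ) ^ θ / 4)
      (by positivity) hcm' (by positivity),
    eventually_mul_pow_le (D := 1) (C := (L : ℝ) ^ θ / 2) (c := 1) (r := Real.exp (-(ζ / 2)))
      (by positivity) (Real.exp_lt_one_iff.2 (by linarith)) (by positivity)]
    with N hN1 hN2 hN3 s hs
  set Q := (stepOp ^ N) (fun m _ => (logWindow N v δ).indicator 1 m) L s with hQ
  set E : ℝ := Real.exp (θ * v + |θ| * δ) ^ N with hE
  have hE0 : 0 < E := by positivity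
  have hmain : ENNReal.ofReal (c ^ N * (L : ℝ) ^ θ) ≤ ENNReal.ofReal E * Q +
      ENNReal.ofReal ((Real.exp (-(η * (v + δ))) * cp) ^ N * (L : ℝ) ^ (θ + η) +
        (Real.exp (η * (v - δ)) * cm) ^ N * (L : ℝ) ^ (θ - η)) := by
    have h1 := le_stepOp_pow hL0 N L le_rfl s hs
    have h2 := stepOp_pow_le hLp N L le_rfl s hs
    have h3 := stepOp_pow_le hLm N L le_rfl s hs
    have h4 := stepOp_pow_mono (L := 1) (f := powObs θ)
      (g := ENNReal.ofReal E • (fun m _ => (logWindow N v δ).indicator 1 m) +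
        (ENNReal.ofReal (Real.exp (-(η * (v + δ))) ^ N) • powObs (θ + η) +
          ENNReal.ofReal (Real.exp (η * (v - δ)) ^ N) • powObs (θ - η)))
      (fun m hm s _ => powObs_le_window hη.le N hm s) N L hL1 s hs
    rw [map_add, map_add, map_smul, map_smul, map_smul] at h4
    rw [ENNReal.ofReal_mul (by positivity), ENNReal.ofReal_pow hc0.le]
    refine (h1.trans h4).trans ?_
    simp only [Pi.add_apply, Pi.smul_apply, smul_eq_mul]
    rw [ENNReal.ofReal_add (by positivity) (by positivity), mul_pow, mul_pow, mul_assoc, mul_assoc,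
      ENNReal.ofReal_mul (by positivity), ENNReal.ofReal_mul (by positivity),
      ENNReal.ofReal_mul (by positivity), ENNReal.ofReal_mul (by positivity),
      ENNReal.ofReal_pow hcp0.le, ENNReal.ofReal_pow hcm0.le]
    gcongr
    · exact h2
    · exact h3
  have hsub : ENNReal.ofReal ((L : ℝ) ^ θ / 2 * c ^ N) ≤ ENNReal.ofReal E * Q := by
    have h5 := tsub_le_iff_right.2 hmain
    rw [← ENNReal.ofReal_sub _ (by positivity)] at h5
    refine le_trans (ENNReal.ofReal_le_ofReal ?_) h5
    linarith
  have hfin : Real.exp (-(v - 1 - Real.log v + ζ)) ^ N ≤ (L : ℝ) ^ θ / 2 * c ^ N / E := by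
    rw [le_div_iff₀ hE0]
    rw [one_pow, mul_one, mul_one] at hN3
    have hθv : θ * v = v - 1 := by rw [hθdef]; field_simp
    have h6 : Real.exp (-(v - 1 - Real.log v + ζ)) * Real.exp (θ * v + |θ| * δ) ≤
        Real.exp (-(ζ / 2)) * c := by
      calc Real.exp (-(v - 1 - Real.log v + ζ)) * Real.exp (θ * v + |θ| * δ)
          ≤ Real.exp (-(ζ / 2) + (Real.log v + -(ζ / 4))) := by
            rw [← Real.exp_add]
            apply Real.exp_le_exp.2
            linarith
        _ = Real.exp (-(ζ / 2)) * (v * Real.exp (-(ζ / 4))) := by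
            rw [Real.exp_add, Real.exp_add, Real.exp_log hv]
        _ ≤ _ := by gcongr
    calc _ = (Real.exp (-(v - 1 - Real.log v + ζ)) * Real.exp (θ * v + |θ| * δ)) ^ N := by
          rw [hE, mul_pow]
      _ ≤ (Real.exp (-(ζ / 2)) * c) ^ N := by gcongr
      _ = Real.exp (-(ζ / 2)) ^ N * c ^ N := mul_pow _ _ _
      _ ≤ _ := by gcongr
  refine (ENNReal.ofReal_le_ofReal hfin).trans ?_
  rw [ENNReal.ofReal_div_of_pos hE0]
  exact ENNReal.div_le_of_le_mul' hsub

/-- From a high level the chain grows like `exp (N v)` with probability at least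
`exp (-N (v - 1 - log v + ζ))`. -/
lemma growth_from_high_level {v δ ζ : ℝ} (hv : 0 < v) (hδ : 0 < δ) (hζ : 0 < ζ) :
    ∃ L : ℕ, 1 ≤ L ∧ ∀ᶠ N : ℕ in atTop, ∀ s ∈ Icc (0 : ℝ) 1,
      ENNReal.ofReal (Real.exp (-(v - 1 - Real.log v + ζ)) ^ N) ≤
        (stepOp ^ N) (fun m _ => (logWindow N v δ).indicator 1 m) L s := by
  set a := |1 - 1 / v| with ha
  have ha0 : 0 ≤ a := abs_nonneg _
  -- The `+ 1` keeps the denominator positive when `v = 1`.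
  set δ' := min δ (ζ / (4 * (a + 1))) with hδ'
  have hδ'0 : 0 < δ' := by positivity
  obtain ⟨L, hL1, hL⟩ := growth_from_high_level_aux hv hδ'0 hζ (by
    calc a * δ' ≤ (a + 1) * (ζ / (4 * (a + 1))) := by
          gcongr
          · linarith
          · exact min_le_right _ _
      _ = ζ / 4 := by field_simp)
  refine ⟨L, hL1, hL.mono fun N hN s hs => (hN s hs).trans ?_⟩
  refine stepOp_pow_mono (L := 1) (fun m _ _ _ => ?_) N L hL1 s hs
  refine indicator_le_indicator_of_subset (fun m hm => ?_) (fun _ => zero_le) m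
  have hm' : |Real.log m - N * v| ≤ N * δ' := hm
  exact hm'.trans (by gcongr; exact min_le_left _ _)

/-- One direct step to `L` has a cost that depends neither on the slope nor on the time horizon. -/
lemma jump_le_stepOp (V : ℕ → ℝ → ℝ≥0∞) {L : ℕ} (hL : 1 ≤ L) {s : ℝ} (hs : s ∈ Icc (0 : ℝ) 1) :
    ENNReal.ofReal (1 / ((L + 1) * (L + 2))) * V L (nextSlope L s) ≤ stepOp V 1 s := by
  have h1 := ENNReal.le_tsum
    (f := fun j => ENNReal.ofReal (transWeight 1 s (1 + j)) * V (1 + j) (nextSlope (1 + j) s))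
    (L - 1)
  rw [Nat.add_sub_cancel' hL] at h1
  refine le_trans ?_ h1
  gcongr
  unfold transWeight
  have := hs.1
  have := hs.2
  have hL0 : (1 : ℝ) ≤ L := by exact_mod_cast hL
  apply div_le_div₀
  · positivity
  · push_cast; linarith
  · positivity
  · apply mul_le_mul <;> linarith

lemma tendsto_sub_floor {κ : ℝ} (hκ : 0 ≤ κ) (hκ1 : κ < 1) :
    Tendsto (fun n : ℕ => n - 1 - ⌊κ * n⌋₊) atTop atTop := by
  refine tendsto_natCast_atTop_iff (R := ℝ) |>.1 ?_
  have h1 : Tendsto (fun n : ℕ => (1 - κ) * (n : ℝ) + -1) atTop atTop :=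
    tendsto_atTop_add_const_right _ _
      (tendsto_natCast_atTop_atTop.const_mul_atTop (by linarith))
  refine tendsto_atTop_mono (fun n => ?_) h1
  have h2 : (⌊κ * n⌋₊ : ℝ) ≤ κ * n := Nat.floor_le (by positivity)
  have h3 : (n : ℝ) ≤ ((n - 1 - ⌊κ * n⌋₊ : ℕ) : ℝ) + 1 + ⌊κ * n⌋₊ := by
    exact_mod_cast (by omega)
  linarith

/-- Staying at level `1` for a proportion `κ` of the time and then growing at speed `v`. -/
lemma le_stepOp_pow_window {κ v δ a : ℝ} (hκ : 0 ≤ κ) (hκ1 : κ < 1) (hv : 0 < v) (hδ : 0 < δ)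
    (ha : κ * Real.log (1 + φ) + (1 - κ) * (v - 1 - Real.log v) < a) :
    ∀ᶠ n : ℕ in atTop, ENNReal.ofReal (Real.exp (-a) ^ n) ≤
      (stepOp ^ n) (fun m _ => {m : ℕ | |Real.log m - n * ((1 - κ) * v)| < n * δ}.indicator 1 m)
        1 0 := by
  have hφ := Real.goldenRatio_pos
  set ℓ := Real.log (1 + φ) with hℓ
  have hℓ0 : 0 ≤ ℓ := Real.log_nonneg (by linarith)
  set J := v - 1 - Real.log v with hJ
  have hJ0 : 0 ≤ J := by have := Real.log_le_sub_one_of_pos hv; linarith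
  set ζ := (a - (κ * ℓ + (1 - κ) * J)) / 2 with hζ
  have hζ0 : 0 < ζ := by linarith
  obtain ⟨L, hL1, hL⟩ := growth_from_high_level hv (half_pos hδ) hζ0
  have h0 : (0 : ℝ) ∈ Icc (0 : ℝ) 1 := by simp
  have hg := stayEigen_ge h0
  set D : ℝ := stayEigen 0 / 2 * (1 / ((L + 1) * (L + 2))) with hD
  have hD0 : 0 < D := by positivity
  -- The growth time differs from `(1 - κ) n` by at most one step, an error of at most `v` that half
  -- of the window `n δ` absorbs.
  have hv' : ∀ᶠ n : ℕ in atTop, v / (δ / 2) < n :=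
    tendsto_natCast_atTop_atTop.eventually_gt_atTop _
  filter_upwards [(tendsto_sub_floor hκ hκ1).eventually hL, hv', eventually_ge_atTop 1,
    (tendsto_sub_floor hκ hκ1).eventually_ge_atTop 1,
    eventually_mul_pow_le (D := 1) (C := D) (c := 1) (r := Real.exp (-ζ))
      (by positivity) (Real.exp_lt_one_iff.2 (by linarith)) hD0] with n hn hnv hn1 hN1 hnD
  set k := ⌊κ * (n : ℝ)⌋₊ with hk
  set N := n - 1 - k with hN
  have hkle : (k : ℝ) ≤ κ * n := Nat.floor_le (by positivity)
  have hklt : κ * n < k + 1 := Nat.lt_floor_add_one _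
  have hnk : n = k + (N + 1) := by omega
  have hnk' : (n : ℝ) = k + (N + 1) := by exact_mod_cast hnk
  have hNle : (N : ℝ) ≤ n * (1 - κ) := by linarith
  have hNge : n * (1 - κ) - 1 ≤ (N : ℝ) := by linarith
  set W : Set ℕ := {m : ℕ | |Real.log m - n * ((1 - κ) * v)| < n * δ} with hW
  set f : ℕ → ℝ → ℝ≥0∞ := fun m _ => W.indicator 1 m with hf
  have hsub : logWindow N v (δ / 2) ⊆ W := by
    intro m hm
    have hm' : |Real.log m - N * v| ≤ N * (δ / 2) := hm
    rw [div_lt_iff₀ (by positivity)] at hnv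
    have hNn : (N : ℝ) * (δ / 2) ≤ n * (δ / 2) := by
      have : (0 : ℝ) ≤ k := Nat.cast_nonneg _
      gcongr; linarith
    have e1 : (N : ℝ) * v ≤ n * (1 - κ) * v := by gcongr
    have e2 : (n * (1 - κ) - 1) * v ≤ (N : ℝ) * v := by gcongr
    obtain ⟨h1, h2⟩ := abs_le.1 hm'
    have h3 : |Real.log m - n * ((1 - κ) * v)| < n * δ :=
      abs_lt.2 ⟨by nlinarith, by nlinarith⟩
    exact h3
  set G : ℝ≥0∞ := ENNReal.ofReal (Real.exp (-(J + ζ)) ^ N) with hG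
  have hjump : ∀ s ∈ Icc (0 : ℝ) 1,
      ENNReal.ofReal (1 / ((L + 1) * (L + 2))) * G ≤ (stepOp ^ (N + 1)) f 1 s := by
    intro s hs
    rw [stepOp_pow_succ]
    refine le_trans ?_ (jump_le_stepOp _ hL1 hs)
    gcongr
    refine (hn _ (nextSlope_mem L hs)).trans ?_
    refine stepOp_pow_mono (L := 1) (fun m _ _ _ => ?_) N L hL1 _ (nextSlope_mem L hs)
    exact indicator_le_indicator_of_subset hsub (fun _ => zero_le) m
  have hstay := le_stepOp_pow_stay _ hjump k 0 h0
  have hcomp : (stepOp ^ n) f = (stepOp ^ k) ((stepOp ^ (N + 1)) f) := by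
    rw [hnk, pow_add]; rfl
  rw [hcomp]
  refine le_trans ?_ hstay
  rw [hG, ← ENNReal.ofReal_mul (by positivity), ← ENNReal.ofReal_mul (by positivity)]
  apply ENNReal.ofReal_le_ofReal
  have e1 : (1 / (1 + φ)) ^ k = Real.exp (-(k * ℓ)) := by
    rw [Real.exp_neg, Real.exp_nat_mul, hℓ, Real.exp_log (by linarith), one_div, inv_pow]
  have e2 : (1 / (1 + φ)) ^ k * stayEigen 0 / 2 *
      (1 / ((L + 1) * (L + 2)) * Real.exp (-(J + ζ)) ^ N) =
      D * Real.exp (-(k * ℓ) + N * (-(J + ζ))) := by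
    rw [e1, Real.exp_add, Real.exp_nat_mul, hD]; ring
  rw [e2]
  rw [one_pow, mul_one, mul_one, ← Real.exp_nat_mul] at hnD
  calc Real.exp (-a) ^ n = Real.exp (n * (-ζ)) * Real.exp (n * (-(a - ζ))) := by
        rw [← Real.exp_nat_mul, ← Real.exp_add]; congr 1; ring
    _ ≤ D * Real.exp (-(k * ℓ) + N * (-(J + ζ))) := by
        gcongr
        have h3 : (k : ℝ) * ℓ ≤ κ * n * ℓ := by gcongr
        have h4 : (N : ℝ) * (J + ζ) ≤ n * (1 - κ) * (J + ζ) := by gcongr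
        have h5 : a - ζ = κ * ℓ + (1 - κ) * J + ζ := by rw [hζ]; ring
        rw [h5]
        have h6 : 0 ≤ n * κ * ζ := by positivity
        linarith

/-! ### The rate function -/

/-- The finite part of the rate function, extended linearly to the whole line. -/
noncomputable def finiteRate (x : ℝ) : ℝ :=
  max x ψ - Real.log (max x ψ + 1) - φ * (min x ψ - ψ)

/-- Identifies `ψ` as the point where `x - log (x + 1)` has derivative `1 - 1 / (x + 1) = -φ`. -/
lemma goldenConj_add_one : ψ + 1 = 1 / (1 + φ) := by
  have := Real.goldenRatio_pos
  rw [eq_div_iff (by linarith)]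
  linear_combination Real.goldenRatio_mul_goldenConj + Real.goldenRatio_add_goldenConj

lemma finiteRate_of_ge {x : ℝ} (hx : ψ ≤ x) : finiteRate x = x - Real.log (x + 1) := by
  simp [finiteRate, hx]

lemma finiteRate_of_le {x : ℝ} (hx : x ≤ ψ) :
    finiteRate x = -φ * (x + 1) + Real.log (1 + φ) := by
  rw [finiteRate, max_eq_right hx, min_eq_left hx, goldenConj_add_one, one_div, Real.log_inv]
  linear_combination Real.goldenRatio_mul_goldenConj + Real.goldenRatio_add_goldenConj

lemma continuous_finiteRate : Continuous finiteRate := by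
  unfold finiteRate
  refine Continuous.sub (Continuous.sub (by fun_prop) (Continuous.log (by fun_prop) fun x => ?_))
    (by fun_prop)
  have := Real.neg_one_lt_goldenConj
  have := le_max_right x ψ
  linarith

lemma finiteRate_nonneg (x : ℝ) : 0 ≤ finiteRate x := by
  have h1 := Real.neg_one_lt_goldenConj
  have h2 := le_max_right x ψ
  have h3 := Real.log_le_sub_one_of_pos (show 0 < max x ψ + 1 by linarith)
  have h4 := mul_nonneg Real.goldenRatio_pos.le (sub_nonneg.2 (min_le_right x ψ))
  unfold finiteRate
  linarith

lemma rateFunction_of_neg_one_le {x : ℝ} (hx : -1 ≤ x) :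
    rateFunction x = (finiteRate x : EReal) := by
  have e : -((√5 - 1) / 2) = ψ := by rw [Real.goldenConj]; ring
  have e2 : (√5 + 1) / 2 = φ := by rw [Real.goldenRatio]; ring
  unfold rateFunction
  rw [e, e2]
  rcases lt_or_ge ψ x with h | h
  · rw [if_pos h, finiteRate_of_ge h.le]
  · rw [if_neg h.not_gt, if_pos hx, finiteRate_of_le h, add_comm 1 φ, ← Real.goldenRatio_sq,
      Real.log_pow]
    norm_num

lemma rateFunction_of_lt_neg_one {x : ℝ} (hx : x < -1) : rateFunction x = ⊤ := by
  have e : -((√5 - 1) / 2) = ψ := by rw [Real.goldenConj]; ring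
  have := Real.neg_one_lt_goldenConj
  unfold rateFunction
  rw [e, if_neg (by linarith), if_neg (by linarith)]

lemma rateFunction_le_iff {x : ℝ} {y : EReal} (hy : y ≠ ⊤) :
    rateFunction x ≤ y ↔ -1 ≤ x ∧ (finiteRate x : EReal) ≤ y := by
  rcases lt_or_ge x (-1) with h | h
  · simp [rateFunction_of_lt_neg_one h, hy, h.not_ge]
  · simp [rateFunction_of_neg_one_le h, h]

lemma isGoodRateFunction_rateFunction : IsGoodRateFunction rateFunction where
  nonneg x := by
    rcases lt_or_ge x (-1) with h | h
    · simp [rateFunction_of_lt_neg_one h]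
    · rw [rateFunction_of_neg_one_le h]; exact_mod_cast finiteRate_nonneg x
  lowerSemicontinuous := by
    rw [lowerSemicontinuous_iff_isClosed_preimage]
    intro y
    rcases eq_or_ne y ⊤ with rfl | hy
    · simp
    · have : rateFunction ⁻¹' Iic y = Ici (-1) ∩ (fun x => (finiteRate x : EReal)) ⁻¹' Iic y := by
        ext x; exact rateFunction_le_iff hy
      rw [this]
      exact isClosed_Ici.inter
        (isClosed_Iic.preimage (continuous_coe_real_ereal.comp continuous_finiteRate))
  isCompact_level c := by
    have : {x | rateFunction x ≤ (c : EReal)} = Ici (-1) ∩ finiteRate ⁻¹' Iic c := by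
      ext x
      refine (rateFunction_le_iff (EReal.coe_ne_top c)).trans ?_
      simp
    rw [this]
    refine (isCompact_Icc (a := (-1 : ℝ)) (b := max 0 (2 * c + 2))).of_isClosed_subset
      (isClosed_Ici.inter (isClosed_Iic.preimage continuous_finiteRate)) ?_
    rintro x ⟨h1, h2⟩
    refine ⟨h1, ?_⟩
    rcases le_or_gt x 0 with h0 | h0
    · exact h0.trans (le_max_left _ _)
    · refine le_trans ?_ (le_max_right _ _)
      have h3 : finiteRate x ≤ c := h2
      rw [finiteRate_of_ge (Real.goldenConj_neg.le.trans h0.le)] at h3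
      -- Halving the argument leaves linear growth of slope `1/2`, whence the bound `2 * c + 2`.
      have h4 := Real.log_le_sub_one_of_pos (show 0 < (x + 1) / 2 by linarith)
      rw [Real.log_div (by linarith) (by norm_num)] at h4
      have h5 := Real.log_two_lt_d9
      linarith

/-! ### The large deviation upper bound -/

/-- The event that the normalised logarithm of the `n`-th partial quotient lies in `Γ`. -/
noncomputable def devEvent (Γ : Set ℝ) (n : ℕ) : Set ℝ :=
  {x | (Real.log (partialQuotient n x : ℝ) - (n : ℝ)) / (n : ℝ) ∈ Γ}

lemma log_ofReal_exp (z : ℝ) : ENNReal.log (ENNReal.ofReal (Real.exp z)) = (z : EReal) := by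
  rw [ENNReal.log_ofReal_of_pos (Real.exp_pos z), Real.log_exp]

/-- Chernoff's bound for the partial quotients. -/
lemma expGrowthSup_le_chernoff {θ y : ℝ} (hθ' : -φ < θ) (hθ : θ < 1) {A : ℕ → Set ℕ}
    (hA : ∀ n, 1 ≤ n → ∀ m ∈ A n, 1 ≤ m → n * (θ * y) ≤ θ * Real.log m) :
    ExpGrowth.expGrowthSup (fun n => lebesgueUnit {x | partialQuotient n x ∈ A n}) ≤
      ((-(θ * y + Real.log (1 - θ)) : ℝ) : EReal) := by
  rw [← EReal.le_of_forall_lt_iff_le]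
  intro z hz
  rw [EReal.coe_lt_coe_iff] at hz
  -- The moment bound with this `c`, times the Chernoff factor `exp (-n θ y)`, grows like `exp (n
  -- z)`.
  have hc : 1 / (1 - θ) < Real.exp (z + θ * y) := by
    rw [one_div, ← Real.exp_log (show 0 < 1 - θ by linarith), ← Real.exp_neg]
    exact Real.exp_lt_exp.2 (by linarith)
  obtain ⟨C, hC0, hC⟩ := exists_stepOp_pow_powObs_le hθ' hθ hc
  have h1 : ∀ᶠ n : ℕ in atTop, lebesgueUnit {x | partialQuotient n x ∈ A n} ≤
      ENNReal.ofReal C * ENNReal.ofReal (Real.exp z) ^ n := by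
    filter_upwards [eventually_ge_atTop 1] with n hn
    rw [lebesgueUnit_partialQuotient _ hn]
    have h2 : (stepOp ^ n) (fun m _ => (A n).indicator 1 m) 1 0 ≤
        (stepOp ^ n) (ENNReal.ofReal (Real.exp (n * (-(θ * y)))) • powObs θ) 1 0 := by
      refine stepOp_pow_mono (L := 1) (fun m hm s _ => ?_) n 1 le_rfl 0 (by simp)
      by_cases h : m ∈ A n
      · rw [indicator_of_mem h, Pi.smul_apply, Pi.smul_apply, powObs_eq_exp hm, smul_eq_mul,
          ← ENNReal.ofReal_mul (Real.exp_nonneg _), ← Real.exp_add, Pi.one_apply,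
          ← ENNReal.ofReal_one]
        apply ENNReal.ofReal_le_ofReal
        rw [Real.one_le_exp_iff]
        linarith [hA n hn m h hm]
      · simp [h]
    rw [map_smul] at h2
    refine h2.trans ?_
    rw [Pi.smul_apply, Pi.smul_apply, smul_eq_mul]
    refine (mul_le_mul_right (hC n) _).trans (le_of_eq ?_)
    rw [← ENNReal.ofReal_pow (Real.exp_nonneg _), ← ENNReal.ofReal_mul (Real.exp_nonneg _),
      ← ENNReal.ofReal_mul hC0.le, mul_left_comm, ← Real.exp_nat_mul, ← Real.exp_nat_mul,
      ← Real.exp_add]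
    ring_nf
  refine (ExpGrowth.expGrowthSup_le_of_eventually_le ENNReal.ofReal_ne_top h1).trans ?_
  rw [ExpGrowth.expGrowthSup_pow, log_ofReal_exp]

/-- Holds at every point, because `log 0 = 0` and division by `n = 0` gives `0`. -/
lemma neg_one_le_normalised (n m : ℕ) : -1 ≤ (Real.log (m : ℝ) - n) / n := by
  have h0 := Real.log_natCast_nonneg m
  rcases Nat.eq_zero_or_pos n with rfl | hn
  · simp
  · have hn0 : (0 : ℝ) < n := by exact_mod_cast hn
    rw [le_div_iff₀ hn0]; linarith

/-- The optimal Chernoff exponent `1 - 1 / (1 + a)` exceeds `-φ` only for `a > ψ`. For smaller `a ≥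
-1`, letting `θ` decrease to `-φ` gives the linear piece. -/
lemma expGrowthSup_Iic_le {a : ℝ} (ha : a ≤ 0) :
    ExpGrowth.expGrowthSup (fun n => lebesgueUnit (devEvent (Iic a) n)) ≤ -rateFunction a := by
  rcases lt_or_ge a (-1) with h | h
  · have : (fun n => lebesgueUnit (devEvent (Iic a) n)) = 0 := by
      ext n
      have : devEvent (Iic a) n = ∅ := by
        ext x
        simpa [devEvent] using h.trans_le (neg_one_le_normalised n _)
      simp [this]
    rw [this, ExpGrowth.expGrowthSup_zero]
    exact bot_le
  have bound : ∀ θ, -φ < θ → θ ≤ 0 →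
      ExpGrowth.expGrowthSup (fun n => lebesgueUnit (devEvent (Iic a) n)) ≤
        ((-(θ * (1 + a) + Real.log (1 - θ)) : ℝ) : EReal) := by
    intro θ hθ hθ0
    refine expGrowthSup_le_chernoff (A := fun n => {m | (Real.log (m : ℝ) - n) / n ≤ a}) hθ
      (by linarith) fun n hn m hm _ => ?_
    have hn0 : (0 : ℝ) < n := by exact_mod_cast hn
    have hm' : (Real.log (m : ℝ) - n) / n ≤ a := hm
    rw [div_le_iff₀ hn0] at hm'
    nlinarith
  rw [rateFunction_of_neg_one_le h, ← EReal.coe_neg]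
  rcases lt_or_ge ψ a with hψ | hψ
  · have h1 : 1 / (1 + φ) < 1 + a := by rw [← goldenConj_add_one]; linarith
    have hφ := Real.goldenRatio_pos
    have h2 : 0 < 1 + a := lt_trans (by positivity) h1
    have h3 : 1 / (1 + a) < 1 + φ := by
      rw [div_lt_comm₀ (by linarith) h2] at h1; exact h1
    have h4 : 1 ≤ 1 / (1 + a) := by rw [le_div_iff₀ h2]; linarith
    refine (bound (1 - 1 / (1 + a)) (by linarith) (by linarith)).trans (le_of_eq ?_)
    rw [finiteRate_of_ge hψ.le, sub_sub_cancel, one_div, Real.log_inv, sub_mul,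
      inv_mul_cancel₀ h2.ne', add_comm a 1]
    congr 1; ring
  · have hcont : ContinuousAt (fun θ : ℝ =>
        ((-(θ * (1 + a) + Real.log (1 - θ)) : ℝ) : EReal)) (-φ) := by
      refine continuous_coe_real_ereal.continuousAt.comp ?_
      have : (1 : ℝ) - -φ ≠ 0 := by have := Real.goldenRatio_pos; linarith
      exact ((continuousAt_id.mul continuousAt_const).add
        ((continuousAt_const.sub continuousAt_id).log this)).neg
    have ht := hcont.tendsto.mono_left (nhdsWithin_le_nhds (s := Ioi (-φ)))
    have e : -(-φ * (1 + a) + Real.log (1 - -φ)) = -finiteRate a := by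
      rw [finiteRate_of_le hψ]; ring_nf
    rw [e] at ht
    refine ge_of_tendsto ht ?_
    filter_upwards [Ioo_mem_nhdsGT (show -φ < 0 by have := Real.goldenRatio_pos; linarith)] with θ hθ
    exact bound θ hθ.1 hθ.2.le

lemma expGrowthSup_Ici_le {a : ℝ} (ha : 0 ≤ a) :
    ExpGrowth.expGrowthSup (fun n => lebesgueUnit (devEvent (Ici a) n)) ≤ -rateFunction a := by
  have h2 : 0 < 1 + a := by linarith
  have h3 : 1 / (1 + a) ≤ 1 := by rw [div_le_one h2]; linarith
  have h4 : 0 < 1 / (1 + a) := by positivity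
  have hφ := Real.goldenRatio_pos
  rw [rateFunction_of_neg_one_le (by linarith), ← EReal.coe_neg]
  refine (expGrowthSup_le_chernoff (A := fun n => {m | a ≤ (Real.log (m : ℝ) - n) / n})
    (θ := 1 - 1 / (1 + a)) (y := 1 + a)
    (by linarith) (by linarith) fun n hn m hm _ => ?_).trans (le_of_eq ?_)
  · have hn0 : (0 : ℝ) < n := by exact_mod_cast hn
    have hm' : a ≤ (Real.log (m : ℝ) - n) / n := hm
    rw [le_div_iff₀ hn0] at hm'
    have : 0 ≤ 1 - 1 / (1 + a) := by linarith
    nlinarith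
  · rw [finiteRate_of_ge (Real.goldenConj_neg.le.trans ha), sub_sub_cancel, one_div, Real.log_inv,
      sub_mul, inv_mul_cancel₀ h2.ne', add_comm a 1]
    congr 1; ring

lemma devEvent_mono {Γ Δ : Set ℝ} (h : Γ ⊆ Δ) (n : ℕ) : devEvent Γ n ⊆ devEvent Δ n :=
  fun _ hx => h hx

/-- Split `Γ` at `0` and enclose each half in the half-line starting at its closure's point nearest
to `0`. The growth rate of a sum is the larger of the two rates. -/
lemma expGrowthSup_devEvent_le (Γ : Set ℝ) :
    ExpGrowth.expGrowthSup (fun n => lebesgueUnit (devEvent Γ n)) ≤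
      -(⨅ x ∈ closure Γ, rateFunction x) := by
  have hneg : ExpGrowth.expGrowthSup (fun n => lebesgueUnit (devEvent (Γ ∩ Iic 0) n)) ≤
      -(⨅ x ∈ closure Γ, rateFunction x) := by
    rcases (closure Γ ∩ Iic 0).eq_empty_or_nonempty with h | h
    · have h' : Γ ∩ Iic 0 = ∅ :=
        subset_empty_iff.1 ((inter_subset_inter_left _ subset_closure).trans h.subset)
      have : (fun n => lebesgueUnit (devEvent (Γ ∩ Iic 0) n)) = 0 := by
        ext n; simp [devEvent, h']
      rw [this, ExpGrowth.expGrowthSup_zero]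
      exact bot_le
    · have hbdd : BddAbove (closure Γ ∩ Iic 0) := ⟨0, fun _ hx => hx.2⟩
      have hmem := (isClosed_closure.inter isClosed_Iic).csSup_mem h hbdd
      refine le_trans (ExpGrowth.expGrowthSup_monotone fun n => measure_mono (devEvent_mono ?_ n))
        ((expGrowthSup_Iic_le hmem.2).trans (EReal.neg_le_neg_iff.2 (iInf₂_le _ hmem.1)))
      exact fun x hx => le_csSup hbdd ⟨subset_closure hx.1, hx.2⟩
  have hpos : ExpGrowth.expGrowthSup (fun n => lebesgueUnit (devEvent (Γ ∩ Ici 0) n)) ≤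
      -(⨅ x ∈ closure Γ, rateFunction x) := by
    rcases (closure Γ ∩ Ici 0).eq_empty_or_nonempty with h | h
    · have h' : Γ ∩ Ici 0 = ∅ :=
        subset_empty_iff.1 ((inter_subset_inter_left _ subset_closure).trans h.subset)
      have : (fun n => lebesgueUnit (devEvent (Γ ∩ Ici 0) n)) = 0 := by
        ext n; simp [devEvent, h']
      rw [this, ExpGrowth.expGrowthSup_zero]
      exact bot_le
    · have hbdd : BddBelow (closure Γ ∩ Ici 0) := ⟨0, fun _ hx => hx.2⟩
      have hmem := (isClosed_closure.inter isClosed_Ici).csInf_mem h hbdd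
      refine le_trans (ExpGrowth.expGrowthSup_monotone fun n => measure_mono (devEvent_mono ?_ n))
        ((expGrowthSup_Ici_le hmem.2).trans (EReal.neg_le_neg_iff.2 (iInf₂_le _ hmem.1)))
      exact fun x hx => csInf_le hbdd ⟨subset_closure hx.1, hx.2⟩
  have hsum : (fun n => lebesgueUnit (devEvent Γ n)) ≤
      (fun n => lebesgueUnit (devEvent (Γ ∩ Iic 0) n)) +
        fun n => lebesgueUnit (devEvent (Γ ∩ Ici 0) n) := by
    intro n
    refine (measure_mono ?_).trans (measure_union_le _ _)
    intro x hx
    rcases le_total ((Real.log (partialQuotient n x : ℝ) - (n : ℝ)) / (n : ℝ)) 0 with h | h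
    · exact Or.inl ⟨hx, h⟩
    · exact Or.inr ⟨hx, h⟩
  refine (ExpGrowth.expGrowthSup_monotone hsum).trans ?_
  rw [ExpGrowth.expGrowthSup_add]
  exact sup_le hneg hpos

/-! ### The large deviation lower bound -/

lemma le_expGrowthInf_of_speed {Γ : Set ℝ} {x κ v : ℝ} (hx : x ∈ interior Γ) (hκ : 0 ≤ κ)
    (hκ1 : κ < 1) (hv : 0 < v) (hxv : (1 - κ) * v = 1 + x) :
    ((-(κ * Real.log (1 + φ) + (1 - κ) * (v - 1 - Real.log v)) : ℝ) : EReal) ≤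
      ExpGrowth.expGrowthInf (fun n => lebesgueUnit (devEvent Γ n)) := by
  rw [← EReal.ge_of_forall_gt_iff_ge]
  intro z hz
  rw [EReal.coe_lt_coe_iff] at hz
  obtain ⟨δ, hδ, hball⟩ := Metric.isOpen_iff.1 isOpen_interior x hx
  have h1 := le_stepOp_pow_window (a := -z) hκ hκ1 hv hδ (by linarith)
  rw [neg_neg, hxv] at h1
  have h2 : (fun n => ENNReal.ofReal (Real.exp z) ^ n) ≤ᶠ[atTop]
      fun n => lebesgueUnit (devEvent Γ n) := by
    filter_upwards [h1, eventually_ge_atTop 1] with n hn hn1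
    rw [← ENNReal.ofReal_pow (Real.exp_nonneg _)]
    refine hn.trans ?_
    rw [← lebesgueUnit_partialQuotient _ hn1]
    refine measure_mono fun ω hω => (?_ : _ ∈ Γ)
    refine interior_subset (hball ?_)
    have hω' : |Real.log (partialQuotient n ω : ℝ) - n * (1 + x)| < n * δ := hω
    have hn0 : (0 : ℝ) < n := by exact_mod_cast hn1
    rw [Metric.mem_ball, Real.dist_eq]
    have e : (Real.log (partialQuotient n ω : ℝ) - (n : ℝ)) / (n : ℝ) - x =
        (Real.log (partialQuotient n ω : ℝ) - n * (1 + x)) / n := by field_simp; ring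
    rw [e, abs_div, abs_of_pos hn0, div_lt_iff₀ hn0]
    linarith
  refine le_trans (le_of_eq ?_) (ExpGrowth.expGrowthInf_eventually_monotone h2)
  rw [ExpGrowth.expGrowthInf_pow, log_ofReal_exp]

/-- Above `ψ` waiting does not pay. Below `ψ`, minimising the cost under `(1 - κ) v = 1 + x` gives
`v = 1 / (1 + φ)` for every `x`, so only the waiting time varies and the cost is affine in `x`. -/
lemma neg_finiteRate_le_expGrowthInf {Γ : Set ℝ} {x : ℝ} (hx : x ∈ interior Γ) (hx1 : -1 < x) :
    ((-finiteRate x : ℝ) : EReal) ≤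
      ExpGrowth.expGrowthInf (fun n => lebesgueUnit (devEvent Γ n)) := by
  have hφ := Real.goldenRatio_pos
  rcases le_or_gt ψ x with h | h
  · refine le_trans (le_of_eq ?_)
      (le_expGrowthInf_of_speed (κ := 0) (v := 1 + x) hx le_rfl one_pos (by linarith) (by ring))
    rw [finiteRate_of_ge h, add_comm x 1]
    congr 1; ring
  · have h1 : x + 1 < 1 / (1 + φ) := by rw [← goldenConj_add_one]; linarith
    rw [lt_div_iff₀ (by linarith)] at h1
    refine le_trans (le_of_eq ?_)
      (le_expGrowthInf_of_speed (κ := 1 - (1 + φ) * (1 + x)) (v := 1 / (1 + φ)) hx (by linarith)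
        (by nlinarith) (by positivity) (by field_simp; ring))
    rw [finiteRate_of_le h.le, one_div, Real.log_inv]
    congr 1
    field_simp
    ring

lemma neg_iInf_le_expGrowthInf (Γ : Set ℝ) :
    -(⨅ x ∈ interior Γ, rateFunction x) ≤
      ExpGrowth.expGrowthInf (fun n => lebesgueUnit (devEvent Γ n)) := by
  rw [EReal.neg_le]
  refine le_iInf₂ fun x hx => ?_
  rw [EReal.neg_le]
  rcases lt_trichotomy x (-1) with h | h | h
  · simp [rateFunction_of_lt_neg_one h]
  -- At `-1` the strategy would need `κ = 1`; a nearby point of the interior to the right has a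
  -- smaller rate and suffices.
  · subst h
    rw [rateFunction_of_neg_one_le le_rfl, ← EReal.coe_neg]
    obtain ⟨δ, hδ, hball⟩ := Metric.isOpen_iff.1 isOpen_interior _ hx
    have hψ := Real.neg_one_lt_goldenConj
    have hη : 0 < min (δ / 2) (ψ + 1) := lt_min (by linarith) (by linarith)
    have h1 := min_le_left (δ / 2) (ψ + 1)
    have h2 := min_le_right (δ / 2) (ψ + 1)
    set η := min (δ / 2) (ψ + 1)
    refine le_trans ?_ (neg_finiteRate_le_expGrowthInf (x := -1 + η) (hball ?_) (by linarith))
    · rw [EReal.coe_le_coe_iff, finiteRate_of_le hψ.le,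
        finiteRate_of_le (show -1 + η ≤ ψ by linarith)]
      have := mul_pos Real.goldenRatio_pos hη
      linarith
    · rw [Metric.mem_ball, Real.dist_eq, add_sub_cancel_left, abs_of_pos hη]
      linarith
  · rw [rateFunction_of_neg_one_le h.le, ← EReal.coe_neg]
    exact neg_finiteRate_le_expGrowthInf hx h

end EngelCF

theorem theorem1 :
    EngelCF.SatisfiesLDP EngelCF.lebesgueUnit
      (fun (n : ℕ) (x : ℝ) => (Real.log (EngelCF.partialQuotient n x : ℝ) - (n : ℝ)) / (n : ℝ))
      EngelCF.rateFunction where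
  measurable n _ := by
    have h : Measurable fun x => (EngelCF.partialQuotient n x : ℝ) :=
      measurable_from_top.comp (EngelCF.measurable_partialQuotient n)
    exact (h.log.sub_const _).div_const _
  goodRate := EngelCF.isGoodRateFunction_rateFunction
  lower Γ _ := EngelCF.neg_iInf_le_expGrowthInf Γ
  upper Γ _ := EngelCF.expGrowthSup_devEvent_le Γ
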